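/- All graphs are finite, simple, undirected and connected, with nonnegative real edge weights. Let $G=(V,E,w)$ be such a graph, $n=|V|$, let $d_G$ be its shortest-path distance and $\mathrm{MST}(G)$ a minimum spanning tree. A spanner of $G$ is a subgraph $H=(V,E')$ with $E'\subseteq E$ and the same weights. It has lightness at most $c$ if $w(H)\le c\cdot w(\mathrm{MST}(G))$, where the weight of a graph is the sum of its edge weights. A pair $u,v$ has distortion at most $t$ in $H$ if $d_H(u,v)\le t\cdot d_G(u,v)$. For $v\in V$ and $\epsilon\in(0,1)$ let $R(v,\epsilon)=\min\{r:|\{u: d_G(u,v)\le r\}|\ge \epsilon n\}$; a vertex $u$ is $\epsilon$-far from $v$ if $d_G(u,v)\ge R(v,\epsilon)$. The spanner $H$ has coarse scaling distortion $\gamma:(0,1)\to\mathbb{R}_+$ if for every $\epsilon\in(0,1)$ every pair $u,v\in V$ such that each of $u,v$ is $\epsilon/2$-far from the other has distortion at most $\gamma(\epsilon)$. For $1\le q<\infty$ the $\ell_q$-distortion of $H$ is $$\mathrm{dist}_q(H,G)=\mathbb{E}\left[\left(\frac{d_H(u,v)}{d_G(u,v)}\right)^q\right]^{1/q},$$ the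 expectation being over a uniformly random pair $\{u,v\}\in\binom{V}{2}$ (with $0/0=0$, $x/0=\infty$ for $x>0$, and value $0$ if $n=1$). **Theorem.** There are universal constants $C>0$ and $k\in\mathbb{N}$ such that for every $0<\rho<1$, every such graph $G$ has a spanner $H$ with 1. lightness at most $1+\rho$; 2. coarse scaling distortion $\tilde O(\log(1/\epsilon))/\rho$, precisely $$\gamma(\epsilon)=\frac{C}{\rho}\,\bigl(1+\ln\tfrac1\epsilon\bigr)\bigl(1+\ln(1+\ln\tfrac1\epsilon)\bigr)^k ;$$ 3. $\ell_q$-distortion $\tilde O(q)/\rho$ for every real $1\le q<\infty$, precisely $$\mathrm{dist}_q(H,G)\le \frac{C}{\rho}\,q\,(1+\ln q)^k .$$ -/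

import Mathlib

open scoped NNReal ENNReal

namespace LightSpanner

/-- The total length of a walk: the sum of the weights of its edges, with multiplicity. -/
noncomputable def walkWeight {V : Type*} {G : SimpleGraph V} (w : Sym2 V → ℝ≥0) {u v : V}
    (p : G.Walk u v) : ℝ≥0∞ :=
  (p.edges.map fun e => (w e : ℝ≥0∞)).sum

/-- The shortest-path distance in the graph `G` with edge weights `w`
(it is `∞` if `u` and `v` are not connected in `G`). -/
noncomputable def wdist {V : Type*} (G : SimpleGraph V) (w : Sym2 V → ℝ≥0) (u v : V) : ℝ≥0∞ :=
  ⨅ p : G.Walk u v, walkWeight w p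

open Classical in
/-- The weight of a graph: the sum of the weights of its edges. -/
noncomputable def weight {V : Type*} [Fintype V] (G : SimpleGraph V) (w : Sym2 V → ℝ≥0) : ℝ≥0∞ :=
  ∑ e ∈ G.edgeFinset, (w e : ℝ≥0∞)

/-- The weight of a minimum spanning tree of `G`: the minimum of the weights of all spanning trees
(there are finitely many, and at least one if `G` is connected). -/
noncomputable def mstWeight {V : Type*} [Fintype V] (G : SimpleGraph V) (w : Sym2 V → ℝ≥0) :
    ℝ≥0∞ :=
  ⨅ T : {T : SimpleGraph V // T ≤ G ∧ T.IsTree}, weight T.1 w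

/-- The lightness of a subgraph `H` of `G`: its weight divided by that of a minimum spanning tree
of `G`. In `ℝ≥0∞` one has `0 / 0 = 0` and `x / 0 = ∞` for `x ≠ 0`, so that lightness at most `c`
means `weight H ≤ c * mstWeight G` also when the minimum spanning tree has weight zero. -/
noncomputable def lightness {V : Type*} [Fintype V] (G H : SimpleGraph V) (w : Sym2 V → ℝ≥0) :
    ℝ≥0∞ :=
  weight H w / mstWeight G w

/-- The pair `u, v` has distortion at most `t` in the spanner `H` of `G`. -/
def PairDistortionLE {V : Type*} (G H : SimpleGraph V) (w : Sym2 V → ℝ≥0) (u v : V) (t : ℝ) :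
    Prop :=
  wdist H w u v ≤ ENNReal.ofReal t * wdist G w u v

/-- `R(v, ε) = min {r : |B(v, r)| ≥ ε n}`, where `B(v, r)` is the closed ball of radius `r` around
`v` in the shortest-path metric of `G` and `n` is the number of vertices. -/
noncomputable def farRadius {V : Type*} [Fintype V] (G : SimpleGraph V) (w : Sym2 V → ℝ≥0)
    (v : V) (ε : ℝ) : ℝ≥0∞ :=
  sInf {r : ℝ≥0∞ | ε * (Fintype.card V : ℝ) ≤ ({u : V | wdist G w v u ≤ r}.ncard : ℝ)}

/-- The vertex `u` is `ε`-far from `v`. -/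
def IsFar {V : Type*} [Fintype V] (G : SimpleGraph V) (w : Sym2 V → ℝ≥0) (ε : ℝ) (u v : V) :
    Prop :=
  farRadius G w v ε ≤ wdist G w u v

/-- `H` has coarse scaling distortion `γ`: for every `ε ∈ (0, 1)`, every pair of vertices that are
`ε/2`-far from each other has distortion at most `γ ε`. -/
def HasCoarseScalingDistortion {V : Type*} [Fintype V] (G H : SimpleGraph V) (w : Sym2 V → ℝ≥0)
    (γ : ℝ → ℝ) : Prop :=
  ∀ ε : ℝ, 0 < ε → ε < 1 → ∀ u v : V,
    IsFar G w (ε / 2) u v → IsFar G w (ε / 2) v u → PairDistortionLE G H w u v (γ ε)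

open Classical in
/-- The `ℓ_q`-distortion of `H`: the `q`-th root of the expectation of `(d_H(u,v) / d_G(u,v)) ^ q`
over a uniformly random pair of distinct vertices. The average is taken over the `n (n - 1)` ordered
pairs; as the ratio is symmetric, this is the average over unordered pairs. -/
noncomputable def lqDistortion {V : Type*} [Fintype V] (G H : SimpleGraph V) (w : Sym2 V → ℝ≥0)
    (q : ℝ) : ℝ≥0∞ :=
  ((∑ x ∈ (Finset.univ : Finset V).offDiag, (wdist H w x.1 x.2 / wdist G w x.1 x.2) ^ q) /
    ((Finset.univ : Finset V).offDiag.card : ℝ≥0∞)) ^ (1 / q)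

end LightSpanner

/-!
The spanner is a minimum spanning tree `T` together with, for each density level
`ε = 2 ^ (-2 ^ i)`, a light set of shortest paths that serves the pairs which are far at this level.

*Reduction to few terminals.* At level `ε` there is a net of at most `1 / ε` vertices such that
every vertex `u` is within twice its `ε`-radius of the net (`exists_density_net`). If `v` is `ε`-far
from `u`, then the detour from `u` to `v` through a net point near `u` costs a constant factor, so
it is enough to preserve the distances from the net points to all vertices. For at most
`2 ^ (2 ^ A - 2)` terminals this is possible with distortion `O(2 ^ A)` and additional weight `O(A)`
times the weight of `T` (`exists_terminal_spanner`). If the edges outside of `T` are stretched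
by a factor `M` beforehand, the additional weight drops by the factor `M` and the distortion grows
by `M` (`exists_terminal_spanner_scaled`). With `A = i + 6` and `M` proportional to
`A (i + 1) (i + 2) / ρ`, the additional weights of all levels sum up to `ρ` times the
weight of `T`, and the distortion at level `i` is `O(2 ^ i (i + 1) ^ 3 / ρ)`
(`exists_spanner_levels`).

*Light sets of pairs.* The vertices are placed on a line of length `P`, twice the weight of `T`, such
that the distances on the line are at least those in `T` (`exists_line_placement`). Let `σ = 2 ^ A`.
Distances below `P / 2 ^ (σ - 2)` are handled by connecting each vertex to a near terminal through
break points on the line, as in shallow-light trees (`exists_pairs_of_terminals`), and by a greedy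
spanner of the short distances between terminals (`exists_pairs_of_short`). The other distances
are, up to a factor two, of the form `2 ^ a δ σ ^ j` with `a < A` and `j < σ`. For a fixed
`a`, the line is cut into fewer than `2 ^ σ` cells of length `2 ^ a δ`, and all the scales `j` are
treated at once, at a total cost of `O(P)` (`exists_light_hierarchy`); the sum over `a` gives the
factor `A`.

*The hierarchy.* At each scale `Δ = σ ^ j` the points are partitioned into clusters with credits
between `Δ` and `60 Δ`; the sum of the credits is the potential. Among the candidate pairs at scale
`Δ` a maximal set `F` without cycles of length below `123 σ Δ` is selected; it spans all the
candidates. The clusters are grouped into connected pieces of mass at least `σ Δ` and diameter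
less than `6 σ Δ`. Edges of `F` at pieces of bounded degree number at most a constant times the
number of pieces, so their total length is a fraction `O(1 / σ)` of the potential, which is
affordable at each of the `σ` scales. All pieces of high degree are absorbed in stars, each with more
than a hundred pieces; merging a star into one cluster at least halves its credit, and
by the Moore bound (`card_edges_le_of_girth`) the number of edges of `F` inside the stars is
at most twice the number of their clusters, which this loss of potential pays for
(`Clustering.step`). The sum of the costs over all scales is therefore linear in the number of cells.

*Distortion.* For the coarse scaling distortion, a level with `2 ^ (-2 ^ i) ≤ ε / 2` is chosen such
that `2 ^ i` is of the order of `log (1 / ε)` (`exists_level`). For the `ℓ_q`-distortion, only a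
fraction `2 ^ (-2 ^ i)` of the pairs is not far at level `i`, so the `q`-th moment is bounded by the
series of the `2 ^ (-2 ^ i) a (i + 1) ^ q`, where `a` is the distortion at each level
(`average_distortion_le`); its terms decay geometrically after the factor
`(O(q (1 + log q) ^ 3)) ^ q` is taken out (`mul_levelBound_rpow_le`).
-/

namespace LightSpanner

/-! ### Chains of weighted steps -/

/-- `Chain E u v x` says that `v` can be reached from `u` by a sequence of steps of total length at
most `x`, where `E u v l` means that there is a step of length `l` from `u` to `v`. -/
inductive Chain {X : Type*} (E : X → X → ℕ → Prop) : X → X → ℕ → Prop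
  | nil (u : X) (x : ℕ) : Chain E u u x
  | cons {u v w : X} {l x y : ℕ} : E u v l → Chain E v w x → l + x ≤ y → Chain E u w y

namespace Chain

variable {X : Type*} {E E' : X → X → ℕ → Prop} {u v w : X} {x y : ℕ}

lemma le (h : Chain E u v x) (hxy : x ≤ y) : Chain E u v y := by
  cases h with
  | nil => exact nil _ _
  | cons h1 h2 h3 => exact cons h1 h2 (h3.trans hxy)

lemma mono (hE : ∀ u v l, E u v l → E' u v l) (h : Chain E u v x) : Chain E' u v x := by
  induction h with
  | nil u x => exact nil _ _
  | cons h1 _ h3 ih => exact cons (hE _ _ _ h1) ih h3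

lemma single {l : ℕ} (h : E u v l) : Chain E u v l := cons h (nil v 0) (by omega)

lemma trans (h : Chain E u v x) (h' : Chain E v w y) : Chain E u w (x + y) := by
  induction h with
  | nil u x => exact h'.le (by omega)
  | cons h1 _ h3 ih => exact cons h1 (ih h') (by omega)

lemma symm (hE : ∀ u v l, E u v l → E v u l) (h : Chain E u v x) : Chain E v u x := by
  induction h with
  | nil u x => exact nil _ _
  | cons h1 _ h3 ih => exact (ih.trans (single (hE _ _ _ h1))).le (by omega)

end Chain

/-- The step relation `E` together with steps of length `Δ` along the pairs in `F`, in both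
directions. -/
def withEdges {X : Type*} (E : X → X → ℕ → Prop) (F : Finset (X × X)) (Δ : ℕ) :
    X → X → ℕ → Prop :=
  fun u v l => E u v l ∨ (((u, v) ∈ F ∨ (v, u) ∈ F) ∧ l = Δ)

lemma withEdges_symm {X : Type*} {E : X → X → ℕ → Prop} (hE : ∀ u v l, E u v l → E v u l)
    (F : Finset (X × X)) (Δ : ℕ) (u v : X) (l : ℕ) (h : withEdges E F Δ u v l) :
    withEdges E F Δ v u l := by
  rcases h with h | ⟨h, rfl⟩
  · exact Or.inl (hE _ _ _ h)
  · exact Or.inr ⟨h.symm, rfl⟩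

lemma withEdges_mono {X : Type*} (E : X → X → ℕ → Prop) {F F' : Finset (X × X)} (hF : F ⊆ F')
    (Δ : ℕ) (u v : X) (l : ℕ) (h : withEdges E F Δ u v l) : withEdges E F' Δ u v l := by
  rcases h with h | ⟨h | h, rfl⟩
  · exact Or.inl h
  · exact Or.inr ⟨Or.inl (hF h), rfl⟩
  · exact Or.inr ⟨Or.inr (hF h), rfl⟩

lemma Chain.withEdges {X : Type*} {E : X → X → ℕ → Prop} (F : Finset (X × X)) (Δ : ℕ) {u v : X}
    {x : ℕ} (h : Chain E u v x) : Chain (LightSpanner.withEdges E F Δ) u v x :=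
  h.mono fun _ _ _ h => Or.inl h

lemma chain_of_mem {X : Type*} {E : X → X → ℕ → Prop} {F : Finset (X × X)} {Δ : ℕ} {p : X × X}
    (hp : p ∈ F) : Chain (withEdges E F Δ) p.1 p.2 Δ :=
  Chain.single (Or.inr ⟨Or.inl hp, rfl⟩)

/-- A chain that may use the additional pair `p` either can avoid it, or decomposes at the first
and the last use of `p`. -/
lemma Chain.of_insert {X : Type*} [DecidableEq X] {E : X → X → ℕ → Prop} {F : Finset (X × X)}
    {Δ : ℕ} {p : X × X} {a b : X} {x : ℕ}
    (h : Chain (LightSpanner.withEdges E (insert p F) Δ) a b x) :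
    Chain (LightSpanner.withEdges E F Δ) a b x ∨
    (∃ y z, y + Δ + z ≤ x ∧ Chain (LightSpanner.withEdges E F Δ) a p.1 y ∧
      Chain (LightSpanner.withEdges E F Δ) p.2 b z) ∨
    (∃ y z, y + Δ + z ≤ x ∧ Chain (LightSpanner.withEdges E F Δ) a p.2 y ∧
      Chain (LightSpanner.withEdges E F Δ) p.1 b z) := by
  induction h with
  | nil u x => exact Or.inl (nil _ _)
  | @cons u v w l x y h1 _ h3 ih =>
    by_cases hs : LightSpanner.withEdges E F Δ u v l
    · rcases ih with ih | ⟨y', z', hyz, h4, h5⟩ | ⟨y', z', hyz, h4, h5⟩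
      · exact Or.inl (cons hs ih h3)
      · exact Or.inr (Or.inl ⟨l + y', z', by omega, cons hs h4 le_rfl, h5⟩)
      · exact Or.inr (Or.inr ⟨l + y', z', by omega, cons hs h4 le_rfl, h5⟩)
    rcases h1 with h1 | ⟨h1, rfl⟩
    · exact absurd (Or.inl h1) hs
    · simp only [Finset.mem_insert] at h1
      rcases h1 with (h1 | h1) | (h1 | h1)
      · subst h1
        rcases ih with ih | ⟨y', z', hyz, h4, h5⟩ | ⟨y', z', hyz, h4, h5⟩
        · exact Or.inr (Or.inl ⟨0, x, by omega, nil _ _, ih⟩)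
        · exact Or.inr (Or.inl ⟨0, z', by omega, nil _ _, h5⟩)
        · exact Or.inl (h5.le (by omega))
      · exact absurd (Or.inr ⟨Or.inl h1, rfl⟩) hs
      · subst h1
        rcases ih with ih | ⟨y', z', hyz, h4, h5⟩ | ⟨y', z', hyz, h4, h5⟩
        · exact Or.inr (Or.inr ⟨0, x, by omega, nil _ _, ih⟩)
        · exact Or.inl (h5.le (by omega))
        · exact Or.inr (Or.inr ⟨0, z', by omega, nil _ _, h5⟩)
      · exact absurd (Or.inr ⟨Or.inr h1, rfl⟩) hs

/-- No pair of `F` is spanned within length `t` by the other pairs together with `E`: every cycle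
through a pair of `F` is longer than `t`. -/
def IsSparse {X : Type*} [DecidableEq X] (E : X → X → ℕ → Prop) (F : Finset (X × X)) (Δ t : ℕ) :
    Prop :=
  ∀ p ∈ F, ¬ Chain (withEdges E (F.erase p) Δ) p.1 p.2 t

/-- A maximal sparse set of pairs spans all the candidate pairs. -/
lemma exists_isSparse_spanning {X : Type*} [DecidableEq X] {E : X → X → ℕ → Prop}
    (hE : ∀ u v l, E u v l → E v u l) (R : Finset (X × X)) (Δ t : ℕ) :
    ∃ F ⊆ R, IsSparse E F Δ t ∧ ∀ p ∈ R, Chain (withEdges E F Δ) p.1 p.2 (t + Δ) := by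
  classical
  obtain ⟨F, hF, hmax⟩ := Finset.exists_max_image (R.powerset.filter fun F => IsSparse E F Δ t)
    Finset.card ⟨∅, by simp [IsSparse]⟩
  simp only [Finset.mem_filter, Finset.mem_powerset] at hF hmax
  refine ⟨F, hF.1, hF.2, fun p hp => ?_⟩
  by_cases hpF : p ∈ F
  · exact (chain_of_mem hpF).le (by omega)
  have hns : ¬ IsSparse E (insert p F) Δ t := fun hs => by
    have := hmax (insert p F) ⟨Finset.insert_subset hp hF.1, hs⟩
    rw [Finset.card_insert_of_notMem hpF] at this
    omega
  simp only [IsSparse, not_forall, not_not] at hns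
  obtain ⟨p', hp', hc⟩ := hns
  rcases Finset.mem_insert.1 hp' with rfl | hp'F
  · rw [Finset.erase_insert hpF] at hc
    exact hc.le (by omega)
  · have hne : p' ≠ p := fun h => hpF (h ▸ hp'F)
    rw [Finset.erase_insert_of_ne hne.symm] at hc
    have hs := withEdges_symm hE F Δ
    have hm : ∀ {a b x}, Chain (withEdges E (F.erase p') Δ) a b x → Chain (withEdges E F Δ) a b x :=
      fun h => h.mono (withEdges_mono E (Finset.erase_subset _ _) Δ)
    rcases hc.of_insert with hc | ⟨y, z, hyz, h1, h2⟩ | ⟨y, z, hyz, h1, h2⟩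
    · exact absurd hc (hF.2 p' hp'F)
    · exact (((hm h1).symm hs).trans ((chain_of_mem hp'F).trans ((hm h2).symm hs))).le (by omega)
    · exact ((hm h2).trans (((chain_of_mem hp'F).symm hs).trans (hm h1))).le (by omega)

/-! ### Multigraphs of large girth are sparse -/

/-- Steps of length one along the edges in `F` of a multigraph with end vertices `a`, `b`. -/
def hop {ε ι : Type*} (a b : ε → ι) (F : Finset ε) : ι → ι → ℕ → Prop :=
  fun u v l => (∃ p ∈ F, (a p = u ∧ b p = v) ∨ (a p = v ∧ b p = u)) ∧ l = 1

lemma hop_symm {ε ι : Type*} (a b : ε → ι) (F : Finset ε) (u v : ι) (l : ℕ)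
    (h : hop a b F u v l) : hop a b F v u l := by
  obtain ⟨⟨p, hp, h⟩, rfl⟩ := h
  exact ⟨⟨p, hp, h.symm⟩, rfl⟩

lemma hop_mono {ε ι : Type*} (a b : ε → ι) {F F' : Finset ε} (hF : F ⊆ F') (u v : ι) (l : ℕ)
    (h : hop a b F u v l) : hop a b F' u v l := by
  obtain ⟨⟨p, hp, h⟩, rfl⟩ := h
  exact ⟨⟨p, hF hp, h⟩, rfl⟩

/-- The set of all vertices within one step of `B`, and a set of edges connecting them to `B` whose
cardinality is the number of new vertices. -/
lemma exists_ball_succ {ε ι : Type*} [DecidableEq ε] [DecidableEq ι] (a b : ε → ι) (F F' : Finset ε)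
    (W B : Finset ι) (v : ι) (j : ℕ) (hFW : ∀ p ∈ F, a p ∈ W ∧ b p ∈ W) (hBW : B ⊆ W)
    (hF' : F' ⊆ F) (hcard : F'.card ≤ B.card) (hch : ∀ u ∈ B, Chain (hop a b F') v u j) :
    ∃ (B₁ : Finset ι) (F₁ : Finset ε), B ⊆ B₁ ∧ B₁ ⊆ W ∧ F₁ ⊆ F ∧ F₁.card ≤ B₁.card ∧
      (∀ u ∈ B₁, Chain (hop a b F₁) v u (j + 1)) ∧
      (∀ p ∈ F, a p ∈ B ∨ b p ∈ B → a p ∈ B₁ ∧ b p ∈ B₁) := by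
  classical
  set New := (W \ B).filter fun u => ∃ p ∈ F, (a p ∈ B ∧ b p = u) ∨ (b p ∈ B ∧ a p = u) with hNew
  have hpar : ∀ u : New, ∃ p ∈ F, (a p ∈ B ∧ b p = u) ∨ (b p ∈ B ∧ a p = u) := fun u =>
    (Finset.mem_filter.1 u.2).2
  choose par hparF hpar using hpar
  set F₁ := F' ∪ New.attach.image par with hF₁
  have hdisj : Disjoint B New :=
    Finset.disjoint_left.2 fun x hx hx' =>
      (Finset.mem_sdiff.1 (Finset.mem_filter.1 hx').1).2 hx
  have hmono : ∀ u v l, hop a b F' u v l → hop a b F₁ u v l :=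
    hop_mono a b Finset.subset_union_left
  refine ⟨B ∪ New, F₁, Finset.subset_union_left, ?_, ?_, ?_, ?_, ?_⟩
  · exact Finset.union_subset hBW ((Finset.filter_subset _ _).trans Finset.sdiff_subset)
  · refine Finset.union_subset hF' fun p hp => ?_
    obtain ⟨u, -, rfl⟩ := Finset.mem_image.1 hp
    exact hparF u
  · rw [Finset.card_union_of_disjoint hdisj]
    refine (Finset.card_union_le _ _).trans (add_le_add hcard ?_)
    exact Finset.card_image_le.trans (by simp)
  · intro u hu
    rcases Finset.mem_union.1 hu with hu | hu
    · exact ((hch u hu).mono hmono).le (by omega)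
    · have hmem : par ⟨u, hu⟩ ∈ F₁ :=
        Finset.mem_union_right _ (Finset.mem_image_of_mem _ (Finset.mem_attach _ _))
      rcases hpar ⟨u, hu⟩ with ⟨h1, h2⟩ | ⟨h1, h2⟩
      · exact ((hch _ h1).mono hmono).trans (Chain.single ⟨⟨_, hmem, Or.inl ⟨rfl, h2⟩⟩, rfl⟩)
      · exact ((hch _ h1).mono hmono).trans (Chain.single ⟨⟨_, hmem, Or.inr ⟨h2, rfl⟩⟩, rfl⟩)
  · intro p hp hpB
    have hin : ∀ u ∈ W, (∃ p ∈ F, (a p ∈ B ∧ b p = u) ∨ (b p ∈ B ∧ a p = u)) → u ∈ B ∪ New := by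
      intro u hu h
      by_cases huB : u ∈ B
      · exact Finset.mem_union_left _ huB
      · exact Finset.mem_union_right _
          (Finset.mem_filter.2 ⟨Finset.mem_sdiff.2 ⟨hu, huB⟩, h⟩)
    rcases hpB with h | h
    · exact ⟨Finset.mem_union_left _ h, hin _ (hFW p hp).2 ⟨p, hp, Or.inl ⟨h, rfl⟩⟩⟩
    · exact ⟨hin _ (hFW p hp).1 ⟨p, hp, Or.inr ⟨h, rfl⟩⟩, Finset.mem_union_left _ h⟩

/-- The Moore bound, in the form: a multigraph without cycles of length at most `2σ` has at most
`2 |W|` edges inside any set `W` of fewer than `2 ^ σ` vertices. A ball whose size at most doubles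
in the next step is found at radius below `σ`; by the girth hypothesis, all edges touching that
ball belong to a spanning tree of the next ball, and the ball can be removed. -/
lemma card_edges_le_of_girth {ε ι : Type*} [DecidableEq ε] [DecidableEq ι] (a b : ε → ι)
    (F : Finset ε) (σ : ℕ) (hg : ∀ p ∈ F, ¬ Chain (hop a b (F.erase p)) (a p) (b p) (2 * σ))
    (W : Finset ι) (hW : W.card < 2 ^ σ) :
    (F.filter fun p => a p ∈ W ∧ b p ∈ W).card ≤ 2 * W.card := by
  induction hn : W.card using Nat.strong_induction_on generalizing W with
  | _ n ih =>
  subst hn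
  rcases W.eq_empty_or_nonempty with rfl | ⟨v, hv⟩
  · simp
  set FW := F.filter fun p => a p ∈ W ∧ b p ∈ W with hFW
  have hFWmem : ∀ p ∈ FW, a p ∈ W ∧ b p ∈ W := fun p hp => (Finset.mem_filter.1 hp).2
  have key : ∃ (j : ℕ) (B B₁ : Finset ι) (F₁ : Finset ε), j < σ ∧ B.Nonempty ∧ B ⊆ W ∧
      F₁ ⊆ FW ∧ F₁.card ≤ 2 * B.card ∧ (∀ u ∈ B₁, Chain (hop a b F₁) v u (j + 1)) ∧
      (∀ p ∈ FW, a p ∈ B ∨ b p ∈ B → a p ∈ B₁ ∧ b p ∈ B₁) := by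
    by_contra hno
    have grow : ∀ j ≤ σ, ∃ (B : Finset ι) (F' : Finset ε), 2 ^ j ≤ B.card ∧ B ⊆ W ∧ F' ⊆ FW ∧
        F'.card ≤ B.card ∧ ∀ u ∈ B, Chain (hop a b F') v u j := by
      intro j
      induction j with
      | zero =>
        intro _
        refine ⟨{v}, ∅, by simp, by simpa using hv, by simp, by simp, ?_⟩
        simp only [Finset.mem_singleton, forall_eq]
        exact Chain.nil _ _
      | succ j ihj =>
        intro hj
        obtain ⟨B, F', h1, h2, h3, h4, h5⟩ := ihj (by omega)
        obtain ⟨B₁, F₁, g1, g2, g3, g4, g5, g6⟩ := exists_ball_succ a b FW F' W B v j hFWmem h2 h3 h4 h5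
        by_cases hd : B₁.card ≤ 2 * B.card
        · have hBne : B.Nonempty := Finset.card_pos.1 (lt_of_lt_of_le (by positivity) h1)
          exact absurd ⟨j, B, B₁, F₁, by omega, hBne, h2, g3, g4.trans hd, g5, g6⟩ hno
        · exact ⟨B₁, F₁, by rw [pow_succ]; omega, g2, g3, g4, g5⟩
    obtain ⟨B, F', h1, h2, -⟩ := grow σ le_rfl
    exact absurd (Finset.card_le_card h2) (by omega)
  obtain ⟨j, B, B₁, F₁, hj, hBne, hBW, hF₁, hcard, hch, htouch⟩ := key
  have hlt : (W \ B).card < W.card := by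
    have := Finset.card_sdiff_add_card_eq_card hBW
    have := hBne.card_pos
    omega
  have hrec := ih _ hlt (W \ B) (by omega) rfl
  have hsub : FW ⊆ F₁ ∪ F.filter fun p => a p ∈ W \ B ∧ b p ∈ W \ B := by
    intro p hp
    obtain ⟨hpF, hpa, hpb⟩ := Finset.mem_filter.1 hp
    by_cases ht : a p ∈ B ∨ b p ∈ B
    · refine Finset.mem_union_left _ ?_
      by_contra hpF₁
      obtain ⟨h1, h2⟩ := htouch p hp ht
      have hsub : F₁ ⊆ F.erase p := fun e he =>
        Finset.mem_erase.2 ⟨fun h => hpF₁ (h ▸ he), (Finset.mem_filter.1 (hF₁ he)).1⟩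
      refine hg p hpF ?_
      exact ((((hch _ h1).symm (hop_symm a b F₁)).trans (hch _ h2)).mono
        (hop_mono a b hsub)).le (by omega)
    · rw [not_or] at ht
      exact Finset.mem_union_right _ (by simp [hpF, hpa, hpb, ht])
  have h1 := (Finset.card_le_card hsub).trans (Finset.card_union_le _ _)
  have := Finset.card_sdiff_add_card_eq_card hBW
  omega

/-! ### Splitting a connected graph into connected pieces of bounded mass -/

/-- The finite vertex sets that are connected with respect to `adj`, as those that can be built up
by adding one adjacent vertex at a time. -/
inductive Grown {ι : Type*} [DecidableEq ι] (adj : ι → ι → Prop) : Finset ι → Prop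
  | single (a : ι) : Grown adj {a}
  | insert {S : Finset ι} {a b : ι} : Grown adj S → b ∉ S → a ∈ S → adj a b →
      Grown adj (Insert.insert b S)

/-- Connectedness of a vertex set in terms of cuts. -/
def Crossing {ι : Type*} (adj : ι → ι → Prop) (N : Finset ι) : Prop :=
  ∀ S ⊆ N, S.Nonempty → S ≠ N → ∃ a ∈ S, ∃ b ∈ N, b ∉ S ∧ adj a b

section Pieces

variable {ι : Type*} [DecidableEq ι] {adj : ι → ι → Prop}

lemma Grown.crossing (hadj : ∀ a b, adj a b → adj b a) {S : Finset ι} (h : Grown adj S) :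
    Crossing adj S := by
  induction h with
  | single a =>
    intro T hT hne hT'
    exact absurd (hne.subset_singleton_iff.1 hT) hT'
  | @insert S a b _ hb ha hab ih =>
    intro T hT hne hT'
    by_cases hbT : b ∈ T
    · have hsub : T.erase b ⊆ S := by
        intro x hx
        obtain ⟨h1, h2⟩ := Finset.mem_erase.1 hx
        exact Finset.mem_of_mem_insert_of_ne (hT h2) h1
      by_cases hemp : (T.erase b).Nonempty
      · have hneS : T.erase b ≠ S := by
          intro h
          exact hT' (by rw [← h, Finset.insert_erase hbT])
        obtain ⟨x, hx, y, hy, hyT, hxy⟩ := ih _ hsub hemp hneS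
        refine ⟨x, Finset.mem_of_mem_erase hx, y, Finset.mem_insert_of_mem hy, fun h => ?_, hxy⟩
        exact hyT (Finset.mem_erase.2 ⟨fun h => hb (h ▸ hy), h⟩)
      · refine ⟨b, hbT, a, Finset.mem_insert_of_mem ha, fun h => hemp ⟨a, ?_⟩, hadj _ _ hab⟩
        exact Finset.mem_erase.2 ⟨fun h => hb (h ▸ ha), h⟩
    · have hsub : T ⊆ S := fun x hx =>
        Finset.mem_of_mem_insert_of_ne (hT hx) fun h => hbT (h ▸ hx)
      by_cases hTS : T = S
      · subst hTS
        exact ⟨a, ha, b, Finset.mem_insert_self _ _, hb, hab⟩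
      · obtain ⟨x, hx, y, hy, hyT, hxy⟩ := ih _ hsub hne hTS
        exact ⟨x, hx, y, Finset.mem_insert_of_mem hy, hyT, hxy⟩

/-- The connected component of `a` inside `M`. -/
lemma exists_grown_closed (M : Finset ι) {a : ι} (ha : a ∈ M) :
    ∃ A ⊆ M, a ∈ A ∧ Grown adj A ∧ ∀ x ∈ A, ∀ y ∈ M, adj x y → y ∈ A := by
  classical
  obtain ⟨A, hA, hmax⟩ := Finset.exists_max_image
    (M.powerset.filter fun A => a ∈ A ∧ Grown adj A) Finset.card
    ⟨{a}, by simp [ha, Grown.single]⟩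
  simp only [Finset.mem_filter, Finset.mem_powerset] at hA hmax
  refine ⟨A, hA.1, hA.2.1, hA.2.2, fun x hx y hy hxy => ?_⟩
  by_contra hyA
  have := hmax (insert y A) ⟨Finset.insert_subset hy hA.1, Finset.mem_insert_of_mem hA.2.1,
    hA.2.2.insert hyA hx hxy⟩
  rw [Finset.card_insert_of_notMem hyA] at this
  omega

lemma Crossing.subset_of_closed {A Z M : Finset ι} (hA : Crossing adj A) (hAM : A ⊆ M)
    (hZ : ∀ x ∈ Z, ∀ y ∈ M, adj x y → y ∈ Z) (hne : (Z ∩ A).Nonempty) : A ⊆ Z := by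
  by_contra hcon
  have hne' : Z ∩ A ≠ A := fun h => hcon (Finset.inter_eq_right.1 h)
  obtain ⟨x, hx, y, hy, hyZ, hxy⟩ := hA _ Finset.inter_subset_right hne hne'
  exact hyZ (Finset.mem_inter.2 ⟨hZ x (Finset.mem_inter.1 hx).1 y (hAM hy) hxy, hy⟩)

lemma Grown.union (hadj : ∀ a b, adj a b → adj b a) {A Q : Finset ι} (hA : Grown adj A)
    (hQ : Grown adj Q) {a b : ι} (ha : a ∈ A) (hb : b ∈ Q) (hab : adj a b) :
    Grown adj (A ∪ Q) := by
  obtain ⟨Z, hZ, haZ, hgr, hcl⟩ := exists_grown_closed (adj := adj) (A ∪ Q)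
    (Finset.mem_union_left Q ha)
  have h1 : A ⊆ Z := (hA.crossing hadj).subset_of_closed Finset.subset_union_left hcl
    ⟨a, by simp [haZ, ha]⟩
  have hbZ : b ∈ Z := hcl a haZ b (Finset.mem_union_right _ hb) hab
  have h2 : Q ⊆ Z := (hQ.crossing hadj).subset_of_closed Finset.subset_union_right hcl
    ⟨b, by simp [hbZ, hb]⟩
  rwa [Finset.Subset.antisymm hZ (Finset.union_subset h1 h2)] at hgr

lemma Crossing.grown {N : Finset ι} (hN : Crossing adj N) (hne : N.Nonempty) : Grown adj N := by
  obtain ⟨a, ha⟩ := hne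
  obtain ⟨Z, hZ, haZ, hgr, hcl⟩ := exists_grown_closed (adj := adj) N ha
  have := hN.subset_of_closed subset_rfl hcl ⟨a, by simp [haZ, ha]⟩
  rwa [Finset.Subset.antisymm hZ this] at hgr

/-- Growing a connected set from `q` until its mass reaches `s`. -/
lemma Crossing.exists_seed {N : Finset ι} (hN : Crossing adj N) (D : ι → ℕ) {s g : ℕ}
    (hD : ∀ a ∈ N, D a ≤ g) (hs : s ≤ ∑ a ∈ N, D a) {q : ι} (hq : q ∈ N) :
    ∃ Q ⊆ N, q ∈ Q ∧ Grown adj Q ∧ s ≤ ∑ a ∈ Q, D a ∧ ∑ a ∈ Q, D a ≤ s + g := by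
  classical
  obtain ⟨A, hA, hmax⟩ := Finset.exists_max_image
    (N.powerset.filter fun A => q ∈ A ∧ Grown adj A ∧ ∑ a ∈ A, D a ≤ s + g) Finset.card
    ⟨{q}, by simpa [hq, Grown.single] using (hD q hq).trans (by omega)⟩
  simp only [Finset.mem_filter, Finset.mem_powerset] at hA hmax
  obtain ⟨h1, h2, h3, h4⟩ := hA
  refine ⟨A, h1, h2, h3, ?_, h4⟩
  by_contra hlt
  have hne : A ≠ N := by
    rintro rfl
    exact hlt hs
  obtain ⟨x, hx, y, hy, hyA, hxy⟩ := hN A h1 ⟨q, h2⟩ hne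
  have := hmax (insert y A) ⟨Finset.insert_subset hy h1, Finset.mem_insert_of_mem h2,
    h3.insert hyA hx hxy, by rw [Finset.sum_insert hyA]; have := hD y hy; omega⟩
  rw [Finset.card_insert_of_notMem hyA] at this
  omega

/-- A connected set of mass at least `s` that cannot be split into two such sets is
within bounded mass of a core point `q`: a connected set `Q` of mass about `s` is grown around `q`, and
every component of the rest has mass less than `s`, as otherwise it could be split off. -/
lemma Crossing.split_or_core (hadj : ∀ a b, adj a b → adj b a) {N : Finset ι}
    (hN : Crossing adj N) (D : ι → ℕ) {s g : ℕ} (hD : ∀ a ∈ N, D a ≤ g)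
    (hs : s ≤ ∑ a ∈ N, D a) (hspos : 0 < s) :
    (∃ A ⊆ N, Crossing adj A ∧ Crossing adj (N \ A) ∧ s ≤ ∑ a ∈ A, D a ∧
      s ≤ ∑ a ∈ N \ A, D a) ∨
    ∃ q ∈ N, ∀ a ∈ N, ∃ A ⊆ N, Grown adj A ∧ a ∈ A ∧ q ∈ A ∧ ∑ a ∈ A, D a ≤ 2 * s + g := by
  have hNne : N.Nonempty := by
    rw [Finset.nonempty_iff_ne_empty]
    rintro rfl
    simp at hs
    omega
  obtain ⟨q, hq⟩ := hNne
  obtain ⟨Q, hQN, hqQ, hQ, hQs, hQg⟩ := hN.exists_seed D hD hs hq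
  rw [or_iff_not_imp_left]
  intro hns
  refine ⟨q, hq, fun a ha => ?_⟩
  by_cases haQ : a ∈ Q
  · exact ⟨Q, hQN, hQ, haQ, hqQ, by omega⟩
  obtain ⟨A, hAM, haA, hA, hcl⟩ := exists_grown_closed (adj := adj) (N \ Q)
    (Finset.mem_sdiff.2 ⟨ha, haQ⟩)
  have hAN : A ⊆ N := hAM.trans Finset.sdiff_subset
  have hAQ : ∀ x ∈ A, x ∉ Q := fun x hx => (Finset.mem_sdiff.1 (hAM hx)).2
  have hcl' : ∀ x ∈ A, ∀ y ∈ N, y ∉ A → adj x y → y ∈ Q := by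
    intro x hx y hy hyA hxy
    by_contra hyQ
    exact hyA (hcl x hx y (Finset.mem_sdiff.2 ⟨hy, hyQ⟩) hxy)
  have hQA : Q ⊆ N \ A := fun x hx =>
    Finset.mem_sdiff.2 ⟨hQN hx, fun h => hAQ x h hx⟩
  have hmass : ∑ a ∈ A, D a < s := by
    by_contra hge
    refine hns ⟨A, hAN, hA.crossing hadj, ?_, by omega,
      hQs.trans (Finset.sum_le_sum_of_subset hQA)⟩
    -- a subset of `N \ A` that misses `Q` is not adjacent to `A`
    have side : ∀ S ⊆ N \ A, S.Nonempty → Disjoint S Q →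
        ∃ a ∈ S, ∃ b ∈ N \ A, b ∉ S ∧ adj a b := by
      intro S hS hSne hSQ
      have hSN : S ≠ N := by
        rintro rfl
        exact Finset.disjoint_left.1 hSQ (hQN hqQ) hqQ
      obtain ⟨x, hx, y, hy, hyS, hxy⟩ := hN S (hS.trans Finset.sdiff_subset) hSne hSN
      refine ⟨x, hx, y, Finset.mem_sdiff.2 ⟨hy, fun hyA => ?_⟩, hyS, hxy⟩
      have hx' := Finset.mem_sdiff.1 (hS hx)
      exact Finset.disjoint_left.1 hSQ hx (hcl' y hyA x hx'.1 hx'.2 (hadj _ _ hxy))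
    intro S hS hSne hSne'
    by_cases h1 : (S ∩ Q).Nonempty
    · by_cases h2 : Q ⊆ S
      · have hT : (N \ A) \ S ⊆ N \ A := Finset.sdiff_subset
        have hTne : ((N \ A) \ S).Nonempty := by
          rw [Finset.sdiff_nonempty]
          exact fun h => hSne' (Finset.Subset.antisymm hS h)
        obtain ⟨x, hx, y, hy, hyT, hxy⟩ := side _ hT hTne
          (Finset.disjoint_left.2 fun x hx hxQ => (Finset.mem_sdiff.1 hx).2 (h2 hxQ))
        refine ⟨y, ?_, x, hT hx, (Finset.mem_sdiff.1 hx).2, hadj _ _ hxy⟩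
        by_contra hyS
        exact hyT (Finset.mem_sdiff.2 ⟨hy, hyS⟩)
      · obtain ⟨x, hx, y, hy, hyS, hxy⟩ := hQ.crossing hadj (S ∩ Q) Finset.inter_subset_right h1
          (fun h => h2 (Finset.inter_eq_right.1 h))
        exact ⟨x, (Finset.mem_inter.1 hx).1, y, hQA hy,
          fun h => hyS (Finset.mem_inter.2 ⟨h, hy⟩), hxy⟩
    · exact side S hS hSne (Finset.disjoint_iff_inter_eq_empty.2
        (Finset.not_nonempty_iff_eq_empty.1 h1))
  have hANne : A ≠ N := by
    rintro rfl
    exact hAQ q hq hqQ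
  obtain ⟨x, hx, y, hy, hyA, hxy⟩ := hN A hAN ⟨a, haA⟩ hANne
  refine ⟨A ∪ Q, Finset.union_subset hAN hQN,
    hA.union hadj hQ hx (hcl' x hx y hy hyA hxy) hxy, Finset.mem_union_left _ haA,
    Finset.mem_union_right _ hqQ, ?_⟩
  have := Finset.sum_union_inter (s₁ := A) (s₂ := Q) (f := D)
  omega

/-- A connected vertex set `N` of mass at least `s` has a partition (given by a labelling `pc` of
its elements) into connected pieces of mass at least `s`, each of which has a core point that is
joined to any other point of the piece by a connected set of mass at most `2 s + g`, where `g`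
bounds the masses of the vertices. -/
lemma Crossing.exists_pieces (hadj : ∀ a b, adj a b → adj b a) {N : Finset ι}
    (hN : Crossing adj N) (D : ι → ℕ) {s g : ℕ} (hD : ∀ a ∈ N, D a ≤ g)
    (hs : s ≤ ∑ a ∈ N, D a) (hspos : 0 < s) :
    ∃ pc : ι → ι, (∀ a ∈ N, pc a ∈ N) ∧ ∀ a ∈ N,
      Grown adj (N.filter fun b => pc b = pc a) ∧
      s ≤ ∑ b ∈ N.filter (fun b => pc b = pc a), D b ∧
      ∃ q ∈ N, ∀ b ∈ N, pc b = pc a →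
        ∃ A ⊆ N, Grown adj A ∧ b ∈ A ∧ q ∈ A ∧ ∑ a ∈ A, D a ≤ 2 * s + g := by
  induction hn : N.card using Nat.strong_induction_on generalizing N with
  | _ n ih =>
  subst hn
  rcases hN.split_or_core hadj D hD hs hspos with ⟨A, hAN, hA, hB, hAs, hBs⟩ | ⟨q, hq, hcore⟩
  · have hpos : ∀ S : Finset ι, s ≤ ∑ a ∈ S, D a → 0 < S.card := by
      intro S hS
      rw [Finset.card_pos, Finset.nonempty_iff_ne_empty]
      rintro rfl
      simp at hS
      omega
    have hcard := Finset.card_sdiff_add_card_eq_card hAN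
    have h1 := hpos _ hAs
    have h2 := hpos _ hBs
    obtain ⟨p₁, hp₁, h₁⟩ := ih A.card (by omega) hA (fun a ha => hD a (hAN ha)) hAs rfl
    obtain ⟨p₂, hp₂, h₂⟩ := ih (N \ A).card (by omega) hB
      (fun a ha => hD a (Finset.sdiff_subset ha)) hBs rfl
    refine ⟨fun a => if a ∈ A then p₁ a else p₂ a, fun a ha => ?_, fun a ha => ?_⟩
    · by_cases haA : a ∈ A
      · simpa [haA] using hAN (hp₁ a haA)
      · simpa [haA] using (Finset.mem_sdiff.1 (hp₂ a (Finset.mem_sdiff.2 ⟨ha, haA⟩))).1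
    · by_cases haA : a ∈ A
      · have hiff : ∀ b ∈ N, (if b ∈ A then p₁ b else p₂ b) = p₁ a ↔ b ∈ A ∧ p₁ b = p₁ a := by
          intro b hb
          by_cases hbA : b ∈ A
          · simp [hbA]
          · simp only [hbA, if_false, false_and, iff_false]
            intro h
            exact (Finset.mem_sdiff.1 (hp₂ b (Finset.mem_sdiff.2 ⟨hb, hbA⟩))).2
              (h ▸ hp₁ a haA)
        have hfib : N.filter (fun b => (if b ∈ A then p₁ b else p₂ b) = p₁ a) =
            A.filter fun b => p₁ b = p₁ a := by
          ext b
          simp only [Finset.mem_filter]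
          constructor
          · rintro ⟨hb, h⟩
            exact (hiff b hb).1 h
          · rintro ⟨hb, h⟩
            exact ⟨hAN hb, (hiff b (hAN hb)).2 ⟨hb, h⟩⟩
        obtain ⟨g1, g2, q, hq, g3⟩ := h₁ a haA
        simp only [haA, if_true, hfib]
        refine ⟨g1, g2, q, hAN hq, fun b hb hba => ?_⟩
        obtain ⟨hbA, hba⟩ := (hiff b hb).1 hba
        obtain ⟨S, hS, r⟩ := g3 b hbA hba
        exact ⟨S, hS.trans hAN, r⟩
      · have haB : a ∈ N \ A := Finset.mem_sdiff.2 ⟨ha, haA⟩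
        have hiff : ∀ b ∈ N, (if b ∈ A then p₁ b else p₂ b) = p₂ a ↔ b ∈ N \ A ∧ p₂ b = p₂ a := by
          intro b hb
          by_cases hbA : b ∈ A
          · simp only [hbA, if_true, Finset.mem_sdiff, not_true_eq_false, and_false, false_and,
              iff_false]
            intro h
            exact (Finset.mem_sdiff.1 (hp₂ a haB)).2 (h ▸ hp₁ b hbA)
          · simp [hbA, hb]
        have hfib : N.filter (fun b => (if b ∈ A then p₁ b else p₂ b) = p₂ a) =
            (N \ A).filter fun b => p₂ b = p₂ a := by
          ext b
          simp only [Finset.mem_filter]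
          constructor
          · rintro ⟨hb, h⟩
            exact (hiff b hb).1 h
          · rintro ⟨hb, h⟩
            exact ⟨Finset.sdiff_subset hb, (hiff b (Finset.sdiff_subset hb)).2 ⟨hb, h⟩⟩
        obtain ⟨g1, g2, q, hq, g3⟩ := h₂ a haB
        simp only [haA, if_false, hfib]
        refine ⟨g1, g2, q, Finset.sdiff_subset hq, fun b hb hba => ?_⟩
        obtain ⟨hbA, hba⟩ := (hiff b hb).1 hba
        obtain ⟨S, hS, r⟩ := g3 b hbA hba
        exact ⟨S, hS.trans Finset.sdiff_subset, r⟩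
  · refine ⟨fun _ => q, fun _ _ => hq, fun a _ => ?_⟩
    simp only [Finset.filter_true]
    exact ⟨hN.grown ⟨q, hq⟩, hs, q, hq, fun b hb _ => hcore b hb⟩

end Pieces

/-! ### Stars around vertices of high degree -/

/-- All vertices in `Hi` and all neighbours of suitable centres in `Hi` can be grouped into disjoint
clusters of radius two that contain the neighbourhood of their centre. Here `nb k` is the
closed neighbourhood of `k`. -/
lemma exists_stars {κ : Type*} [DecidableEq κ] (K Hi : Finset κ) (hHi : Hi ⊆ K)
    (nb : κ → Finset κ) (hnb : ∀ k ∈ K, nb k ⊆ K) (hself : ∀ k, k ∈ nb k) :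
    ∃ (S : Finset κ) (ζ : κ → κ), Hi ⊆ S ∧ S ⊆ K ∧ (∀ k ∈ S, ζ k ∈ S ∧ ζ k ∈ Hi) ∧
      (∀ k ∈ S, ∃ y, y ∈ nb k ∧ y ∈ nb (ζ k)) ∧
      ∀ k ∈ S, nb (ζ k) ⊆ S.filter fun k' => ζ k' = ζ k := by
  classical
  -- the centres: a maximal set of vertices in `Hi` with disjoint closed neighbourhoods
  obtain ⟨Z, hZ, hmax⟩ := Finset.exists_max_image
    (Hi.powerset.filter fun Z => ∀ z ∈ Z, ∀ z' ∈ Z, z ≠ z' → Disjoint (nb z) (nb z')) Finset.card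
    ⟨∅, by simp⟩
  simp only [Finset.mem_filter, Finset.mem_powerset] at hZ hmax
  obtain ⟨hZHi, hZd⟩ := hZ
  have hnear : ∀ k ∈ Hi, ∃ z ∈ Z, ∃ y, y ∈ nb k ∧ y ∈ nb z := by
    intro k hk
    by_contra hno
    push Not at hno
    have hkZ : k ∉ Z := fun h => hno k h k (hself k) (hself k)
    have := hmax (insert k Z) ⟨Finset.insert_subset hk hZHi, ?_⟩
    · rw [Finset.card_insert_of_notMem hkZ] at this
      omega
    · intro z hz z' hz' hne
      rcases Finset.mem_insert.1 hz with h1 | h1 <;> rcases Finset.mem_insert.1 hz' with h2 | h2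
      · exact absurd (h1.trans h2.symm) hne
      · exact h1 ▸ Finset.disjoint_left.2 fun y hy => hno z' h2 y hy
      · exact h2 ▸ Finset.disjoint_right.2 fun y hy => hno z h1 y hy
      · exact hZd z h1 z' h2 hne
  have hex : ∀ k, ∃ z, (k ∈ Hi ∪ Z.biUnion nb → z ∈ Z ∧ ∃ y, y ∈ nb k ∧ y ∈ nb z) ∧
      ∀ z' ∈ Z, k ∈ nb z' → z = z' := by
    intro k
    by_cases h : ∃ z ∈ Z, k ∈ nb z
    · obtain ⟨z, hz, hkz⟩ := h
      refine ⟨z, fun _ => ⟨hz, k, hself k, hkz⟩, fun z' hz' hkz' => ?_⟩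
      by_contra hne
      exact Finset.disjoint_left.1 (hZd z hz z' hz' hne) hkz hkz'
    · by_cases hk : k ∈ Hi
      · obtain ⟨z, hz, hy⟩ := hnear k hk
        exact ⟨z, fun _ => ⟨hz, hy⟩, fun z' hz' hk' => absurd ⟨z', hz', hk'⟩ h⟩
      · refine ⟨k, fun hk' => ?_, fun z' hz' hk' => absurd ⟨z', hz', hk'⟩ h⟩
        rcases Finset.mem_union.1 hk' with hk' | hk'
        · exact absurd hk' hk
        · exact absurd (Finset.mem_biUnion.1 hk') h
  choose ζ hζ1 hζ2 using hex
  refine ⟨Hi ∪ Z.biUnion nb, ζ, Finset.subset_union_left, ?_, ?_, ?_, ?_⟩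
  · exact Finset.union_subset hHi (Finset.biUnion_subset.2 fun z hz => hnb z (hHi (hZHi hz)))
  · exact fun k hk => ⟨Finset.mem_union_left _ (hZHi (hζ1 k hk).1), hZHi (hζ1 k hk).1⟩
  · exact fun k hk => (hζ1 k hk).2
  · intro k hk x hx
    have hz := (hζ1 k hk).1
    exact Finset.mem_filter.2 ⟨Finset.mem_union_right _ (Finset.mem_biUnion.2 ⟨_, hz, hx⟩),
      hζ2 x _ hz hx⟩

/-! ### One level of the hierarchical clustering -/

/-- A clustering of `X`, given by labels `cl`. The credit `D c` of a cluster exceeds the diameter of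
the cluster with respect to `E`-chains, so that the total credit bounds the diameter of
a cluster obtained by joining clusters along steps of length one. -/
structure Clustering {X : Type*} (E : X → X → ℕ → Prop) (cl : X → X) (D : X → ℕ) (lo hi : ℕ) :
    Prop where
  conn : ∀ u v, cl u = cl v → ∃ x, Chain E u v x ∧ x + 1 ≤ D (cl u)
  lo_le : ∀ u, lo ≤ D (cl u)
  le_hi : ∀ u, D (cl u) ≤ hi

/-- The total credit of the clusters. -/
def potential {X : Type*} [Fintype X] [DecidableEq X] (cl : X → X) (D : X → ℕ) : ℕ :=
  ∑ c ∈ Finset.univ.image cl, D c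

/-- Two clusters are adjacent if a step of length one leads from one to the other. -/
def clusterAdj {X : Type*} (E : X → X → ℕ → Prop) (cl : X → X) (a b : X) : Prop :=
  ∃ u v, cl u = a ∧ cl v = b ∧ E u v 1

section Step

variable {X : Type*} {E : X → X → ℕ → Prop} {cl : X → X} {D : X → ℕ}
  {lo hi : ℕ}

lemma clusterAdj_symm (hE : ∀ u v l, E u v l → E v u l) (a b : X) (h : clusterAdj E cl a b) :
    clusterAdj E cl b a := by
  obtain ⟨u, v, hu, hv, huv⟩ := h
  exact ⟨v, u, hv, hu, hE _ _ _ huv⟩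

/-- A chain of steps along edges of `F` between clusters gives a chain in `X`. -/
lemma Clustering.chain_of_hop [DecidableEq X] (hE : ∀ u v l, E u v l → E v u l)
    (hC : Clustering E cl D lo hi) (F : Finset (X × X)) (Δ : ℕ) {a b : X} {n : ℕ}
    (h : Chain (hop (fun p : X × X => cl p.1) (fun p => cl p.2) F) a b n) :
    ∀ u v, cl u = a → cl v = b → Chain (withEdges E F Δ) u v (n * (Δ + hi) + hi) := by
  have base : ∀ u v, cl u = cl v → Chain (withEdges E F Δ) u v hi := fun u v huv => by
    obtain ⟨x, hx, hx'⟩ := hC.conn u v huv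
    exact (hx.withEdges F Δ).le (by have := hC.le_hi u; omega)
  induction h with
  | nil a n =>
    intro u v hu hv
    exact (base u v (hu.trans hv.symm)).le (by omega)
  | @cons a c b l x y h1 h2 h3 ih =>
    intro u v hu hv
    obtain ⟨⟨p, hp, hpac⟩, rfl⟩ := h1
    have hle : Δ + hi + (x * (Δ + hi) + hi) ≤ y * (Δ + hi) + hi := by
      have := Nat.mul_le_mul_right (Δ + hi) h3
      rw [add_mul, one_mul] at this
      omega
    rcases hpac with ⟨h4, h5⟩ | ⟨h4, h5⟩
    · refine (((base u p.1 (hu.trans h4.symm)).trans (chain_of_mem hp)).trans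
        (ih p.2 v h5 hv)).le (by omega)
    · refine (((base u p.2 (hu.trans h5.symm)).trans ((chain_of_mem hp).symm
        (withEdges_symm hE F Δ))).trans (ih p.1 v h4 hv)).le (by omega)

variable [DecidableEq X]

/-- In a connected set of clusters any two points are joined by a chain whose length is less than the
total credit: the step of length one between adjacent clusters is paid for by the
strict inequality between diameter and credit. -/
lemma Clustering.chain_of_grown (hE : ∀ u v l, E u v l → E v u l) (hC : Clustering E cl D lo hi)
    {A : Finset X} (hA : Grown (clusterAdj E cl) A) :
    ∀ u v, cl u ∈ A → cl v ∈ A → ∃ x, Chain E u v x ∧ x + 1 ≤ ∑ c ∈ A, D c := by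
  induction hA with
  | single a =>
    intro u v hu hv
    rw [Finset.mem_singleton] at hu hv
    obtain ⟨x, hx, hx'⟩ := hC.conn u v (hu.trans hv.symm)
    exact ⟨x, hx, by simpa [hu] using hx'⟩
  | @insert S a b _ hb ha hab ih =>
    rw [Finset.sum_insert hb]
    have key : ∀ u v, cl u = b → cl v ∈ S → ∃ x, Chain E u v x ∧ x + 1 ≤ D b + ∑ c ∈ S, D c := by
      intro u v hu hv
      obtain ⟨u₁, v₁, hu₁, hv₁, h1⟩ := hab
      obtain ⟨x, hx, hx'⟩ := hC.conn u v₁ (hu.trans hv₁.symm)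
      obtain ⟨y, hy, hy'⟩ := ih u₁ v (hu₁ ▸ ha) hv
      rw [hu] at hx'
      exact ⟨x + 1 + y, (hx.trans (Chain.single (hE _ _ _ h1))).trans hy, by omega⟩
    intro u v hu hv
    rcases Finset.mem_insert.1 hu with hu | hu <;> rcases Finset.mem_insert.1 hv with hv | hv
    · obtain ⟨x, hx, hx'⟩ := hC.conn u v (hu.trans hv.symm)
      rw [hu] at hx'
      exact ⟨x, hx, by omega⟩
    · exact key u v hu hv
    · obtain ⟨x, hx, hx'⟩ := key v u hv hu
      exact ⟨x, hx.symm hE, hx'⟩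
    · obtain ⟨x, hx, hx'⟩ := ih u v hu hv
      exact ⟨x, hx, by omega⟩

/-- Closed neighbourhood of the piece `k` in the multigraph with edges `F`, where `p` gives the
piece of a point. -/
def nbhd (p : X → X) (F : Finset (X × X)) (k : X) : Finset X :=
  insert k ((F.filter fun e => p e.1 = k).image (fun e => p e.2) ∪
    (F.filter fun e => p e.2 = k).image (fun e => p e.1))

/-- The edges of `F` with an end in the piece `k`. -/
def incident (p : X → X) (F : Finset (X × X)) (k : X) : Finset (X × X) :=
  F.filter fun e => p e.1 = k ∨ p e.2 = k

/-- If cycles through `F` are long, then a piece has as many neighbours as incident edges. -/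
lemma card_incident_le (hE : ∀ u v l, E u v l → E v u l) {p : X → X} {d Δ t : ℕ}
    (hp : ∀ u v, p u = p v → Chain E u v d) {F : Finset (X × X)} (hF : IsSparse E F Δ t)
    (ht : 2 * d + Δ ≤ t) (k : X) : (incident p F k).card ≤ (nbhd p F k).card := by
  classical
  have hmem : ∀ e ∈ incident p F k, e ∈ F ∧ (p e.1 = k ∨ p e.2 = k) := fun e he =>
    Finset.mem_filter.1 he
  refine Finset.card_le_card_of_injOn (fun e => if p e.1 = k then p e.2 else p e.1) ?_ ?_
  · intro e he
    obtain ⟨h1, h2⟩ := hmem e he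
    by_cases h : p e.1 = k
    · simp only [h, if_true, nbhd]
      exact Finset.mem_coe.2 (Finset.mem_insert_of_mem (Finset.mem_union_left _
        (Finset.mem_image.2 ⟨e, Finset.mem_filter.2 ⟨h1, h⟩, rfl⟩)))
    · simp only [h, if_false, nbhd]
      exact Finset.mem_coe.2 (Finset.mem_insert_of_mem (Finset.mem_union_right _
        (Finset.mem_image.2 ⟨e, Finset.mem_filter.2 ⟨h1, h2.resolve_left h⟩, rfl⟩)))
  · intro e he e' he' heq
    obtain ⟨h1, h2⟩ := hmem e he
    obtain ⟨h1', h2'⟩ := hmem e' he'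
    by_contra hne
    have he'F : e' ∈ F.erase e := Finset.mem_erase.2 ⟨fun h => hne h.symm, h1'⟩
    have hin : ∀ u v, p u = p v → Chain (withEdges E (F.erase e) Δ) u v d := fun u v h =>
      (hp u v h).withEdges _ _
    have s := withEdges_symm hE (F.erase e) Δ
    have cases : (p e.1 = p e'.1 ∧ p e.2 = p e'.2) ∨ (p e.1 = p e'.2 ∧ p e.2 = p e'.1) := by
      by_cases h : p e.1 = k <;> by_cases h' : p e'.1 = k <;>
        simp only [h, h', if_true, if_false] at heq
      · exact Or.inl ⟨h.trans h'.symm, heq⟩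
      · exact Or.inr ⟨h.trans (h2'.resolve_left h').symm, heq⟩
      · exact Or.inr ⟨heq, (h2.resolve_left h).trans h'.symm⟩
      · exact Or.inl ⟨heq, (h2.resolve_left h).trans (h2'.resolve_left h').symm⟩
    refine hF e h1 ?_
    rcases cases with ⟨h3, h4⟩ | ⟨h3, h4⟩
    · exact (((hin _ _ h3).trans (chain_of_mem he'F)).trans (hin _ _ h4.symm)).le (by omega)
    · exact (((hin _ _ h3).trans ((chain_of_mem he'F).symm s)).trans (hin _ _ h4.symm)).le (by omega)

/-- Points of a piece and of a neighbouring piece are joined by a short chain. -/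
lemma chain_of_mem_nbhd (hE : ∀ u v l, E u v l → E v u l) {p : X → X} {d Δ : ℕ}
    (hp : ∀ u v, p u = p v → Chain E u v d) {F : Finset (X × X)} {k : X} {u v : X}
    (hu : p u = k) (hv : p v ∈ nbhd p F k) : Chain (withEdges E F Δ) u v (2 * d + Δ) := by
  have hin : ∀ u v, p u = p v → Chain (withEdges E F Δ) u v d := fun u v h =>
      (hp u v h).withEdges _ _
  rcases Finset.mem_insert.1 hv with h | h
  · exact (hin u v (hu.trans h.symm)).le (by omega)
  rcases Finset.mem_union.1 h with h | h
  · obtain ⟨e, he, hev⟩ := Finset.mem_image.1 h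
    obtain ⟨heF, hek⟩ := Finset.mem_filter.1 he
    exact (((hin u e.1 (hu.trans hek.symm)).trans (chain_of_mem heF)).trans (hin e.2 v hev)).le
      (by omega)
  · obtain ⟨e, he, hev⟩ := Finset.mem_image.1 h
    obtain ⟨heF, hek⟩ := Finset.mem_filter.1 he
    exact (((hin u e.2 (hu.trans hek.symm)).trans ((chain_of_mem heF).symm
      (withEdges_symm hE F Δ))).trans (hin e.1 v hev)).le (by omega)

variable [Fintype X]

/-- `X` is connected by steps of length one. -/
def UnitConnected (E : X → X → ℕ → Prop) : Prop :=
  ∀ S : Finset X, S.Nonempty → S ≠ Finset.univ → ∃ u ∈ S, ∃ v, v ∉ S ∧ E u v 1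

lemma UnitConnected.crossing (hconn : UnitConnected E) (cl : X → X) :
    Crossing (clusterAdj E cl) (Finset.univ.image cl) := by
  intro S hS hne hne'
  obtain ⟨s, hs⟩ := hne
  obtain ⟨u₀, -, hu₀⟩ := Finset.mem_image.1 (hS hs)
  obtain ⟨u, hu, v, hv, huv⟩ := hconn (Finset.univ.filter fun u => cl u ∈ S)
    ⟨u₀, by simp [hu₀, hs]⟩ (fun h => hne' (Finset.Subset.antisymm hS fun c hc => by
      obtain ⟨u, -, rfl⟩ := Finset.mem_image.1 hc
      have := Finset.mem_univ u
      rw [← h] at this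
      simpa using this))
  simp only [Finset.mem_filter, Finset.mem_univ, true_and] at hu hv
  exact ⟨cl u, hu, cl v, Finset.mem_image_of_mem _ (Finset.mem_univ _), hv, u, v, rfl, rfl, huv⟩

lemma Clustering.chain_le_potential (hE : ∀ u v l, E u v l → E v u l) (hconn : UnitConnected E)
    (hC : Clustering E cl D lo hi) (u v : X) : ∃ x, Chain E u v x ∧ x + 1 ≤ potential cl D :=
  hC.chain_of_grown hE ((hconn.crossing cl).grown
    ⟨cl u, Finset.mem_image_of_mem _ (Finset.mem_univ _)⟩) u v
    (Finset.mem_image_of_mem _ (Finset.mem_univ _)) (Finset.mem_image_of_mem _ (Finset.mem_univ _))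

/-- Total credit of the clusters in the piece `k`. -/
def pieceMass (cl : X → X) (D : X → ℕ) (pc : X → X) (k : X) : ℕ :=
  ∑ c ∈ (Finset.univ.image cl).filter (fun c => pc c = k), D c

lemma sum_pieceMass (cl : X → X) (D : X → ℕ) (pc : X → X) (S : Finset X) :
    ∑ k ∈ S, pieceMass cl D pc k = ∑ c ∈ (Finset.univ.image cl).filter (fun c => pc c ∈ S), D c := by
  unfold pieceMass
  rw [← Finset.sum_fiberwise_of_maps_to (s := (Finset.univ.image cl).filter (fun c => pc c ∈ S))
    (t := S) (g := pc) (fun c hc => (Finset.mem_filter.1 hc).2)]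
  refine Finset.sum_congr rfl fun k hk => Finset.sum_congr ?_ fun _ _ => rfl
  ext c
  simp only [Finset.mem_filter]
  constructor
  · rintro ⟨h1, rfl⟩
    exact ⟨⟨h1, hk⟩, rfl⟩
  · rintro ⟨⟨h1, _⟩, rfl⟩
    exact ⟨h1, rfl⟩

/-- Grouping of clusters into connected pieces of mass at least `σ Δ` and diameter less than
`6 σ Δ`. -/
lemma Clustering.exists_pieces (hE : ∀ u v l, E u v l → E v u l) (hconn : UnitConnected E)
    {σ Δ : ℕ} (hσ : 60 ≤ σ) (hΔ : 0 < Δ) (hC : Clustering E cl D Δ (60 * Δ))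
    (hΦ : σ * Δ ≤ potential cl D) :
    ∃ pc : X → X, (∀ u, σ * Δ ≤ pieceMass cl D pc (pc (cl u))) ∧
      ∀ u v, pc (cl u) = pc (cl v) → ∃ x, Chain E u v x ∧
        x + 1 ≤ min (pieceMass cl D pc (pc (cl u))) (6 * (σ * Δ)) := by
  have hmem : ∀ u, cl u ∈ Finset.univ.image cl := fun u =>
    Finset.mem_image_of_mem _ (Finset.mem_univ _)
  obtain ⟨pc, -, hpc⟩ := (hconn.crossing cl).exists_pieces (clusterAdj_symm hE) D
    (s := σ * Δ) (g := 60 * Δ) (fun a ha => by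
      obtain ⟨u, -, rfl⟩ := Finset.mem_image.1 ha
      exact hC.le_hi u) hΦ (by positivity)
  refine ⟨pc, fun u => (hpc _ (hmem u)).2.1, fun u v huv => ?_⟩
  obtain ⟨h1, -, q, hq, h3⟩ := hpc _ (hmem u)
  obtain ⟨x, hx, hx'⟩ := hC.chain_of_grown hE h1 u v (by simp) (by simp [huv])
  obtain ⟨w, -, rfl⟩ := Finset.mem_image.1 hq
  obtain ⟨A, -, hA, huA, hwA, hAm⟩ := h3 _ (hmem u) rfl
  obtain ⟨B, -, hB, hvB, hwB, hBm⟩ := h3 _ (hmem v) huv.symm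
  obtain ⟨y, hy, hy'⟩ := hC.chain_of_grown hE hA u w huA hwA
  obtain ⟨z, hz, hz'⟩ := hC.chain_of_grown hE hB w v hwB hvB
  have hσΔ : 60 * Δ ≤ σ * Δ := Nat.mul_le_mul_right _ hσ
  rcases le_total x (y + z) with h | h
  · exact ⟨x, hx, le_min hx' (by omega)⟩
  · exact ⟨y + z, hy.trans hz, le_min (by unfold pieceMass; omega) (by omega)⟩

/-- The number of edges of a sparse set `F`, in terms of the mass of a set `S` of pieces that
contains all pieces of high degree: edges inside `S` are controlled by the Moore bound, all other
edges are incident to a piece of low degree. -/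
lemma Clustering.card_sparse_le (hE : ∀ u v l, E u v l → E v u l) {σ Δ : ℕ} (hσ : 60 ≤ σ)
    (hC : Clustering E cl D Δ (60 * Δ)) (hX : Fintype.card X < 2 ^ σ)
    {F : Finset (X × X)} (hF : IsSparse E F Δ (123 * (σ * Δ))) (pc : X → X) (S : Finset X) (c₀ : ℕ)
    (hS : ∀ k, c₀ < (incident (fun u => pc (cl u)) F k).card → k ∈ S)
    (hmass : ∀ u, σ * Δ ≤ pieceMass cl D pc (pc (cl u))) :
    F.card * (σ * Δ) ≤ 2 * σ * ∑ k ∈ S, pieceMass cl D pc k + c₀ * potential cl D := by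
  classical
  set p : X → X := fun u => pc (cl u) with hp
  set K := Finset.univ.image p with hK
  have hmemK : ∀ u, p u ∈ K := fun u => Finset.mem_image_of_mem _ (Finset.mem_univ _)
  have hmem : ∀ u, cl u ∈ Finset.univ.image cl := fun u =>
    Finset.mem_image_of_mem _ (Finset.mem_univ _)
  set W := (Finset.univ.image cl).filter fun c => pc c ∈ S with hW
  have hWcard : W.card < 2 ^ σ :=
    lt_of_le_of_lt ((Finset.card_le_univ W)) hX
  have hmoore := card_edges_le_of_girth (fun e : X × X => cl e.1) (fun e => cl e.2) F σ
    (fun e he hch => hF e he ?_) W hWcard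
  swap
  · refine (hC.chain_of_hop hE (F.erase e) Δ hch e.1 e.2 rfl rfl).le ?_
    have : 60 * Δ ≤ σ * Δ := Nat.mul_le_mul_right _ hσ
    calc 2 * σ * (Δ + 60 * Δ) + 60 * Δ = 122 * (σ * Δ) + 60 * Δ := by ring
      _ ≤ 123 * (σ * Δ) := by omega
  have hsub : F ⊆ (F.filter fun e => cl e.1 ∈ W ∧ cl e.2 ∈ W) ∪
      (K \ S).biUnion fun k => incident p F k := by
    intro e he
    by_cases h : p e.1 ∈ S ∧ p e.2 ∈ S
    · exact Finset.mem_union_left _ (Finset.mem_filter.2 ⟨he,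
        Finset.mem_filter.2 ⟨hmem _, h.1⟩, Finset.mem_filter.2 ⟨hmem _, h.2⟩⟩)
    · refine Finset.mem_union_right _ (Finset.mem_biUnion.2 ?_)
      rw [not_and_or] at h
      rcases h with h | h
      · exact ⟨p e.1, Finset.mem_sdiff.2 ⟨hmemK _, h⟩, Finset.mem_filter.2 ⟨he, Or.inl rfl⟩⟩
      · exact ⟨p e.2, Finset.mem_sdiff.2 ⟨hmemK _, h⟩, Finset.mem_filter.2 ⟨he, Or.inr rfl⟩⟩
  have hcard : F.card ≤ 2 * W.card + K.card * c₀ := by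
    refine (Finset.card_le_card hsub).trans ((Finset.card_union_le _ _).trans
      (add_le_add hmoore ?_))
    refine (Finset.card_biUnion_le_card_mul _ _ c₀ fun k hk => ?_).trans
      (Nat.mul_le_mul_right _ (Finset.card_le_card Finset.sdiff_subset))
    by_contra hlt
    exact (Finset.mem_sdiff.1 hk).2 (hS k (by omega))
  have hWm : W.card * Δ ≤ ∑ k ∈ S, pieceMass cl D pc k := by
    rw [sum_pieceMass, ← smul_eq_mul]
    refine Finset.card_nsmul_le_sum _ _ _ fun c hc => ?_
    obtain ⟨u, -, rfl⟩ := Finset.mem_image.1 (Finset.mem_filter.1 hc).1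
    exact hC.lo_le u
  have hKm : K.card * (σ * Δ) ≤ potential cl D := by
    have : potential cl D = ∑ k ∈ K, pieceMass cl D pc k := by
      rw [sum_pieceMass, potential]
      refine Finset.sum_congr ?_ fun _ _ => rfl
      ext c
      simp only [Finset.mem_filter, iff_self_and]
      intro hc
      obtain ⟨u, -, rfl⟩ := Finset.mem_image.1 hc
      exact hmemK u
    rw [this, ← smul_eq_mul]
    refine Finset.card_nsmul_le_sum _ _ _ fun k hk => ?_
    obtain ⟨u, -, rfl⟩ := Finset.mem_image.1 hk
    exact hmass u
  calc F.card * (σ * Δ) ≤ (2 * W.card + K.card * c₀) * (σ * Δ) := Nat.mul_le_mul_right _ hcard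
    _ = 2 * σ * (W.card * Δ) + c₀ * (K.card * (σ * Δ)) := by ring
    _ ≤ _ := add_le_add (Nat.mul_le_mul_left _ hWm) (Nat.mul_le_mul_left _ hKm)

/-- One step of the hierarchy: clusters at scale `Δ` are merged into clusters at scale `σ Δ`, and
the number of edges in a sparse set of pairs at scale `Δ` is paid for by the decrease of the
potential, up to a small fraction of the potential. -/
lemma Clustering.step (hE : ∀ u v l, E u v l → E v u l) (hconn : UnitConnected E)
    {σ Δ : ℕ} (hσ : 60 ≤ σ) (hΔ : 0 < Δ) (hC : Clustering E cl D Δ (60 * Δ))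
    (hX : Fintype.card X < 2 ^ σ) (hΦ : σ * Δ ≤ potential cl D)
    {F : Finset (X × X)} (hF : IsSparse E F Δ (123 * (σ * Δ))) :
    ∃ (cl' D' : X → _), Clustering (withEdges E F Δ) cl' D' (σ * Δ) (60 * (σ * Δ)) ∧
      potential cl' D' ≤ potential cl D ∧ F.card * (σ * Δ) + 4 * σ * potential cl' D' ≤
        4 * σ * potential cl D + 104 * potential cl D := by
  classical
  obtain ⟨pc, hmass, hpc⟩ := hC.exists_pieces hE hconn hσ hΔ hΦ
  set p : X → X := fun u => pc (cl u) with hp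
  set K := Finset.univ.image p with hK
  have hmemK : ∀ u, p u ∈ K := fun u => Finset.mem_image_of_mem _ (Finset.mem_univ _)
  have hσΔ : 60 * Δ ≤ σ * Δ := Nat.mul_le_mul_right _ hσ
  have hd : ∀ u v, p u = p v → Chain E u v (6 * (σ * Δ) - 1) := fun u v h => by
    obtain ⟨x, hx, hx'⟩ := hpc u v h
    exact hx.le (by have := hx'.trans (min_le_right _ _); omega)
  have hnbK : ∀ k ∈ K, nbhd p F k ⊆ K := by
    intro k hk x hx
    simp only [nbhd, Finset.mem_insert, Finset.mem_union, Finset.mem_image] at hx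
    rcases hx with rfl | ⟨e, -, rfl⟩ | ⟨e, -, rfl⟩
    · exact hk
    · exact hmemK _
    · exact hmemK _
  obtain ⟨S, ζ, hHiS, hSK, hζS, hlink, hstar⟩ := exists_stars K
    (K.filter fun k => 104 < (incident p F k).card) (Finset.filter_subset _ _) (nbhd p F) hnbK
    (fun k => Finset.mem_insert_self _ _)
  have hcount := hC.card_sparse_le hE hσ hX hF pc S 104 (fun k hk => hHiS
    (Finset.mem_filter.2 ⟨?_, hk⟩)) hmass
  swap
  · obtain ⟨e, he⟩ := Finset.card_pos.1 (lt_of_le_of_lt (Nat.zero_le _) hk)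
    rcases (Finset.mem_filter.1 he).2 with h | h
    · exact h ▸ hmemK e.1
    · exact h ▸ hmemK e.2
  set M := pieceMass cl D pc with hM
  set q : X → X := fun k => if k ∈ S then ζ k else k with hq
  -- the clusters of one star are merged, all other pieces become clusters; the credit of a star is
  -- twice the bound `26 σ Δ` on the length of a chain to its centre
  set D' : X → ℕ := fun k => if k ∈ S then 52 * (σ * Δ) else min (M k) (6 * (σ * Δ)) with hD'
  have hqS : ∀ k, q k ∈ S ↔ k ∈ S := by
    intro k
    by_cases hk : k ∈ S
    · simp [hq, hk, (hζS k hk).1]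
    · simp [hq, hk]
  -- every piece of a star is joined to the centre through a common neighbouring piece
  have hcentre : ∀ u w, p u ∈ S → p w = ζ (p u) →
      Chain (withEdges E F Δ) u w (26 * (σ * Δ) - 2) := by
    intro u w hu hw
    obtain ⟨y, hy1, hy2⟩ := hlink _ hu
    obtain ⟨v, -, rfl⟩ := Finset.mem_image.1 (hnbK _ (hmemK u) hy1)
    have h1 := chain_of_mem_nbhd (Δ := Δ) hE hd (rfl : p u = p u) hy1
    have h2 := chain_of_mem_nbhd (Δ := Δ) hE hd hw hy2
    exact (h1.trans (h2.symm (withEdges_symm hE F Δ))).le (by omega)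
  have hclust : Clustering (withEdges E F Δ) (fun u => q (p u)) D' (σ * Δ) (60 * (σ * Δ)) := by
    refine ⟨fun u v huv => ?_, fun u => ?_, fun u => ?_⟩
    · by_cases hu : p u ∈ S
      · have hv : p v ∈ S := by rw [← hqS, ← huv, hqS]; exact hu
        have huv' : ζ (p u) = ζ (p v) := by simpa [hq, hu, hv] using huv
        obtain ⟨w, -, hw⟩ := Finset.mem_image.1 (hSK (hζS _ hu).1)
        have h1 := hcentre u w hu hw
        have h2 := hcentre v w hv (hw.trans huv')
        refine ⟨_, h1.trans (h2.symm (withEdges_symm hE F Δ)), ?_⟩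
        simp only [hD', hqS, hu, if_true]
        omega
      · have hv : p v ∉ S := by rw [← hqS, ← huv, hqS]; exact hu
        have huv' : p u = p v := by simpa [hq, hu, hv] using huv
        obtain ⟨x, hx, hx'⟩ := hpc u v huv'
        refine ⟨x, hx.withEdges _ _, ?_⟩
        simpa [hD', hqS, hu, hq] using hx'
    · by_cases hu : p u ∈ S
      · simp only [hD', hqS, hu, if_true]
        omega
      · have := hmass u
        simp only [hD', hqS, hu, if_false]
        simp only [hq, hu, if_false]
        exact le_min this (by omega)
    · by_cases hu : p u ∈ S
      · simp only [hD', hqS, hu, if_true]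
        omega
      · simp only [hD', hqS, hu, if_false]
        exact (min_le_right _ _).trans (by omega)
  refine ⟨fun u => q (p u), D', hclust, ?_⟩
  -- a star has at least `104` pieces, so merging it halves its total credit
  have hstarmass : ∑ z ∈ S.image ζ, 2 * (52 * (σ * Δ)) ≤ ∑ k ∈ S, M k := by
    rw [← Finset.sum_fiberwise_of_maps_to (s := S) (t := S.image ζ) (g := ζ)
      (fun k hk => Finset.mem_image_of_mem _ hk)]
    refine Finset.sum_le_sum fun z hz => ?_
    obtain ⟨k, hk, rfl⟩ := Finset.mem_image.1 hz
    have h1 : 104 ≤ (S.filter fun k' => ζ k' = ζ k).card := by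
      have h2 := (Finset.mem_filter.1 (hζS k hk).2).2
      have h3 := card_incident_le hE hd hF (by omega) (ζ k)
      have h4 := Finset.card_le_card (hstar k hk)
      omega
    calc 2 * (52 * (σ * Δ)) = 104 * (σ * Δ) := by ring
      _ ≤ (S.filter fun k' => ζ k' = ζ k).card * (σ * Δ) := Nat.mul_le_mul_right _ h1
      _ ≤ _ := by
        rw [← smul_eq_mul]
        refine Finset.card_nsmul_le_sum _ _ _ fun k' hk' => ?_
        obtain ⟨u, -, rfl⟩ := Finset.mem_image.1 (hSK (Finset.mem_filter.1 hk').1)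
        exact hmass u
  have himg : Finset.univ.image (fun u => q (p u)) ⊆ (K \ S) ∪ S.image ζ := by
    intro c hc
    obtain ⟨u, -, rfl⟩ := Finset.mem_image.1 hc
    by_cases hu : p u ∈ S
    · exact Finset.mem_union_right _ (Finset.mem_image.2 ⟨p u, hu, by simp [hq, hu]⟩)
    · refine Finset.mem_union_left _ ?_
      simp only [hq, hu, if_false]
      exact Finset.mem_sdiff.2 ⟨hmemK u, hu⟩
  have hpot' : potential (fun u => q (p u)) D' ≤
      ∑ k ∈ K \ S, M k + ∑ z ∈ S.image ζ, 52 * (σ * Δ) := by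
    refine (Finset.sum_le_sum_of_subset himg).trans ?_
    have hdis : Disjoint (K \ S) (S.image ζ) := Finset.disjoint_left.2 fun k hk hk' => by
      obtain ⟨j, hj, rfl⟩ := Finset.mem_image.1 hk'
      exact (Finset.mem_sdiff.1 hk).2 (hζS j hj).1
    rw [Finset.sum_union hdis]
    refine add_le_add (Finset.sum_le_sum fun k hk => ?_) (Finset.sum_le_sum fun z hz => ?_)
    · simp only [hD', (Finset.mem_sdiff.1 hk).2, if_false]
      exact min_le_left _ _
    · obtain ⟨k', hk', rfl⟩ := Finset.mem_image.1 hz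
      simp only [hD', (hζS k' hk').1, if_true]
      exact le_rfl
  have hpot : potential cl D = ∑ k ∈ K \ S, M k + ∑ k ∈ S, M k := by
    rw [Finset.sum_sdiff hSK, hM, sum_pieceMass, potential]
    refine Finset.sum_congr ?_ fun _ _ => rfl
    ext c
    simp only [Finset.mem_filter, iff_self_and]
    intro hc
    obtain ⟨u, -, rfl⟩ := Finset.mem_image.1 hc
    exact hmemK u
  rw [← Finset.mul_sum] at hstarmass
  set A := ∑ z ∈ S.image ζ, 52 * (σ * Δ)
  set m := ∑ k ∈ S, M k
  set r := ∑ k ∈ K \ S, M k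
  have h1 : 2 * potential (fun u => q (p u)) D' + m ≤ 2 * potential cl D := by omega
  have h2 := Nat.mul_le_mul_left (2 * σ) h1
  have h3 : 2 * σ * (2 * potential (fun u => q (p u)) D' + m) =
    4 * σ * potential (fun u => q (p u)) D' + 2 * σ * m := by ring
  have h4 : 2 * σ * (2 * potential cl D) = 4 * σ * potential cl D := by ring
  exact ⟨by omega, by omega⟩

end Step

/-! ### The hierarchy over all levels -/

/-- The steps `E` together with, for each level `j < i`, the pairs in `F j` as steps of length
`σ ^ j`. -/
def levelEdges {X : Type*} (E : X → X → ℕ → Prop) (F : ℕ → Finset (X × X)) (σ : ℕ) :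
    ℕ → X → X → ℕ → Prop
  | 0 => E
  | i + 1 => withEdges (levelEdges E F σ i) (F i) (σ ^ i)

section Hierarchy

variable {X : Type*} {E : X → X → ℕ → Prop}

lemma levelEdges_congr {F F' : ℕ → Finset (X × X)} (σ : ℕ) {i : ℕ} (h : ∀ j < i, F j = F' j) :
    levelEdges E F σ i = levelEdges E F' σ i := by
  induction i with
  | zero => rfl
  | succ i ih => rw [levelEdges, levelEdges, ih fun j hj => h j (by omega), h i (by omega)]

lemma levelEdges_symm (hE : ∀ u v l, E u v l → E v u l) (F : ℕ → Finset (X × X)) (σ i : ℕ) :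
    ∀ u v l, levelEdges E F σ i u v l → levelEdges E F σ i v u l := by
  induction i with
  | zero => exact hE
  | succ i ih => exact withEdges_symm ih _ _

lemma base_levelEdges (F : ℕ → Finset (X × X)) (σ i : ℕ) {u v : X} {l : ℕ} (h : E u v l) :
    levelEdges E F σ i u v l := by
  induction i with
  | zero => exact h
  | succ i ih => exact Or.inl ih

lemma levelEdges_cases {F : ℕ → Finset (X × X)} {σ i : ℕ} {u v : X} {l : ℕ}
    (h : levelEdges E F σ i u v l) :
    E u v l ∨ ∃ j < i, ((u, v) ∈ F j ∨ (v, u) ∈ F j) ∧ l = σ ^ j := by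
  induction i with
  | zero => exact Or.inl h
  | succ i ih =>
    rcases h with h | ⟨h, hl⟩
    · rcases ih h with h | ⟨j, hj, h⟩
      · exact Or.inl h
      · exact Or.inr ⟨j, by omega, h⟩
    · exact Or.inr ⟨i, by omega, h, hl⟩

/-- Given arbitrary sets `R i` of pairs at the scales `σ ^ i`, there are subsets `F i` of total
length linear in the number of points that span all pairs of `R i` up to a factor `O(σ)`,
provided that there are fewer than `2 ^ σ` points. -/
theorem exists_light_hierarchy [Fintype X] [DecidableEq X] (hE : ∀ u v l, E u v l → E v u l)
    (hconn : UnitConnected E) {σ : ℕ} (hσ : 60 ≤ σ) (hX : Fintype.card X < 2 ^ σ)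
    (R : ℕ → Finset (X × X)) :
    ∃ F : ℕ → Finset (X × X), (∀ i, F i ⊆ R i) ∧
      (∑ i ∈ Finset.range σ, (F i).card * σ ^ i ≤ 108 * Fintype.card X) ∧
      ∀ i < σ, ∀ p ∈ R i, Chain (levelEdges E F σ σ) p.1 p.2 (124 * σ * σ ^ i) := by
  set m := Fintype.card X with hm
  -- at level `i`, either all points are already joined by chains of length `σ ^ i`, or there is a
  -- clustering whose potential has paid for the pairs selected so far
  have main : ∀ i, ∃ F : ℕ → Finset (X × X), (∀ j, F j ⊆ R j) ∧
      (∀ j < i, ∀ p ∈ R j, Chain (levelEdges E F σ i) p.1 p.2 (124 * σ * σ ^ j)) ∧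
      ((σ * (∑ j ∈ Finset.range i, (F j).card * σ ^ j) ≤ 4 * σ * m + i * (104 * m) ∧
        ∀ u v, Chain (levelEdges E F σ i) u v (σ ^ i)) ∨
      ∃ cl D, Clustering (levelEdges E F σ i) cl D (σ ^ i) (60 * σ ^ i) ∧ potential cl D ≤ m ∧
        σ * (∑ j ∈ Finset.range i, (F j).card * σ ^ j) + 4 * σ * potential cl D ≤
          4 * σ * m + i * (104 * m)) := by
    intro i
    induction i with
    | zero =>
      have hpot : potential (fun u : X => u) (fun _ => 1) = m := by
        simp [potential, hm]
      refine ⟨fun _ => ∅, by simp, by simp, Or.inr ⟨fun u => u, fun _ => 1, ⟨?_, by simp, by simp⟩,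
        hpot.le, by simp [hpot]⟩⟩
      rintro u v rfl
      exact ⟨0, Chain.nil _ _, le_rfl⟩
    | succ i ih =>
      obtain ⟨F, hFR, hsp, h⟩ := ih
      have hs := levelEdges_symm hE F σ i
      -- `F i` is replaced by `Fi`
      have upd : ∀ Fi ⊆ R i, let F' := Function.update F i Fi
          (∀ j, F' j ⊆ R j) ∧ levelEdges E F' σ (i + 1) = withEdges (levelEdges E F σ i) Fi (σ ^ i) ∧
          ∑ j ∈ Finset.range (i + 1), (F' j).card * σ ^ j =
            ∑ j ∈ Finset.range i, (F j).card * σ ^ j + Fi.card * σ ^ i := by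
        intro Fi hFi F'
        have hne : ∀ j < i, F' j = F j := fun j hj => Function.update_of_ne (by omega) _ _
        have heq : F' i = Fi := Function.update_self _ _ _
        refine ⟨fun j => ?_, ?_, ?_⟩
        · by_cases hj : j = i
          · subst hj
            rw [heq]
            exact hFi
          · rw [show F' j = F j from Function.update_of_ne hj _ _]
            exact hFR j
        · rw [levelEdges, heq, levelEdges_congr σ hne]
        · rw [Finset.sum_range_succ, heq]
          congr 1
          exact Finset.sum_congr rfl fun j hj => by rw [hne j (Finset.mem_range.1 hj)]
      have hpow : σ ^ (i + 1) = σ * σ ^ i := by ring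
      have hpos : 0 < σ ^ i := by positivity
      have hle : σ ^ i ≤ σ * σ ^ i := Nat.le_mul_of_pos_left _ (by omega)
      -- once all points are joined by chains of length `σ ^ (i + 1)`, no further pairs are needed
      have finish : (∀ u v, Chain (levelEdges E F σ i) u v (σ ^ (i + 1))) →
          σ * (∑ j ∈ Finset.range i, (F j).card * σ ^ j) ≤ 4 * σ * m + i * (104 * m) →
          ∃ F : ℕ → Finset (X × X), (∀ j, F j ⊆ R j) ∧
          (∀ j < i + 1, ∀ p ∈ R j, Chain (levelEdges E F σ (i + 1)) p.1 p.2 (124 * σ * σ ^ j)) ∧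
          ((σ * (∑ j ∈ Finset.range (i + 1), (F j).card * σ ^ j) ≤
            4 * σ * m + (i + 1) * (104 * m) ∧
            ∀ u v, Chain (levelEdges E F σ (i + 1)) u v (σ ^ (i + 1))) ∨
          ∃ cl D, Clustering (levelEdges E F σ (i + 1)) cl D (σ ^ (i + 1)) (60 * σ ^ (i + 1)) ∧
            potential cl D ≤ m ∧
            σ * (∑ j ∈ Finset.range (i + 1), (F j).card * σ ^ j) + 4 * σ * potential cl D ≤
              4 * σ * m + (i + 1) * (104 * m)) := by
        intro hall hcost
        obtain ⟨h1, h2, h3⟩ := upd ∅ (Finset.empty_subset _)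
        refine ⟨_, h1, fun j hj p hp => ?_, Or.inl ⟨?_, fun u v => ?_⟩⟩
        · rw [h2]
          rcases Nat.lt_succ_iff_lt_or_eq.1 hj with hj | rfl
          · exact (hsp j hj p hp).withEdges _ _
          · exact ((hall p.1 p.2).withEdges _ _).le (by rw [hpow, mul_assoc]; omega)
        · rw [h3]
          simp only [Finset.card_empty, zero_mul, add_zero]
          rw [add_mul]
          omega
        · rw [h2]
          exact (hall u v).withEdges _ _
      rcases h with ⟨hcost, hall⟩ | ⟨cl, D, hC, hpm, hcost⟩
      · exact finish (fun u v => (hall u v).le (by omega)) hcost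
      · by_cases hΦ : σ * σ ^ i ≤ potential cl D
        · obtain ⟨Fi, hFi, hsparse, hspan⟩ := exists_isSparse_spanning hs (R i) (σ ^ i)
            (123 * (σ * σ ^ i))
          obtain ⟨cl', D', hC', hpot', hpot⟩ := hC.step hs
            (fun S h1 h2 => by
              obtain ⟨u, hu, v, hv, huv⟩ := hconn S h1 h2
              exact ⟨u, hu, v, hv, base_levelEdges F σ i huv⟩) hσ hpos hX hΦ hsparse
          obtain ⟨h1, h2, h3⟩ := upd Fi hFi
          have hcost' : σ * (∑ j ∈ Finset.range i, (F j).card * σ ^ j + Fi.card * σ ^ i) +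
              4 * σ * potential cl' D' ≤ 4 * σ * m + (i + 1) * (104 * m) := by
            have e1 : σ * (∑ j ∈ Finset.range i, (F j).card * σ ^ j + Fi.card * σ ^ i) =
              σ * (∑ j ∈ Finset.range i, (F j).card * σ ^ j) + Fi.card * (σ * σ ^ i) := by ring
            have e2 : 104 * potential cl D ≤ 104 * m := Nat.mul_le_mul_left _ hpm
            rw [e1, add_mul (i : ℕ) 1]
            omega
          refine ⟨_, h1, fun j hj p hp => ?_, Or.inr ⟨cl', D', ?_, ?_, ?_⟩⟩
          · rw [h2]
            rcases Nat.lt_succ_iff_lt_or_eq.1 hj with hj | rfl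
            · exact (hsp j hj p hp).withEdges _ _
            · exact (hspan p hp).le (by rw [mul_assoc]; omega)
          · rw [h2, hpow]
            exact hC'
          · exact hpot'.trans hpm
          · rw [h3]
            exact hcost'
        · refine finish (fun u v => ?_) (by omega)
          obtain ⟨x, hx, hx'⟩ := hC.chain_le_potential hs (fun S h1 h2 => by
              obtain ⟨u, hu, v, hv, huv⟩ := hconn S h1 h2
              exact ⟨u, hu, v, hv, base_levelEdges F σ i huv⟩) u v
          exact hx.le (by omega)
  obtain ⟨F, h1, h2, h3⟩ := main σ
  refine ⟨F, h1, ?_, h2⟩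
  have hcost : σ * (∑ j ∈ Finset.range σ, (F j).card * σ ^ j) ≤ 4 * σ * m + σ * (104 * m) := by
    rcases h3 with ⟨h, -⟩ | ⟨cl, D, -, -, h⟩
    · exact h
    · omega
  refine Nat.le_of_mul_le_mul_left (hcost.trans (le_of_eq ?_)) (by omega : 0 < σ)
  ring

end Hierarchy

/-! ### Light sets of pairs in a finite pseudometric space on a line -/

/-- `d` is a (finite) pseudometric. -/
structure IsPseudoDist {V : Type*} (d : V → V → ℝ) : Prop where
  self : ∀ u, d u u = 0
  symm : ∀ u v, d u v = d v u
  triangle : ∀ u v w, d u w ≤ d u v + d v w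

lemma IsPseudoDist.nonneg {V : Type*} {d : V → V → ℝ} (h : IsPseudoDist d) (u v : V) :
    0 ≤ d u v := by
  have h1 := h.triangle u v u
  rw [h.self, h.symm v u] at h1
  linarith

/-- Steps of length one between consecutive cells. -/
def pathSteps (m : ℕ) : Fin m → Fin m → ℕ → Prop :=
  fun c c' l => ((c : ℕ) + 1 = c' ∨ (c' : ℕ) + 1 = c) ∧ l = 1

lemma pathSteps_symm (m : ℕ) (c c' : Fin m) (l : ℕ) (h : pathSteps m c c' l) :
    pathSteps m c' c l := ⟨h.1.symm, h.2⟩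

lemma unitConnected_pathSteps (m : ℕ) : UnitConnected (pathSteps m) := by
  intro S ⟨a, ha⟩ hne
  by_contra hno
  push Not at hno
  have hstep : ∀ c ∈ S, ∀ c' : Fin m, ((c : ℕ) + 1 = c' ∨ (c' : ℕ) + 1 = c) → c' ∈ S := by
    intro c hc c' h
    by_contra hc'
    exact hno c hc c' hc' ⟨h, rfl⟩
  have up : ∀ k : ℕ, ∀ c : Fin m, (c : ℕ) = a + k → c ∈ S := by
    intro k
    induction k with
    | zero => intro c hc; rwa [show c = a from Fin.ext (by simpa using hc)]
    | succ k ih =>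
      intro c hc
      exact hstep ⟨a + k, by have := c.2; omega⟩ (ih _ rfl) c (Or.inl (by simp; omega))
  have down : ∀ k : ℕ, ∀ c : Fin m, (c : ℕ) + k = a → c ∈ S := by
    intro k
    induction k with
    | zero => intro c hc; rwa [show c = a from Fin.ext (by simpa using hc)]
    | succ k ih =>
      intro c hc
      exact hstep ⟨c + 1, by have := a.2; omega⟩ (ih _ (by simp; omega)) c (Or.inr rfl)
  refine hne (Finset.eq_univ_iff_forall.2 fun c => ?_)
  rcases le_total (c : ℕ) a with h | h
  · exact down (a - c) c (by omega)
  · exact up (c - a) c (by omega)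

section SumBounds

variable {α β M : Type*} [DecidableEq β] [AddCommMonoid M] [PartialOrder M] [IsOrderedAddMonoid M]
  {f : β → M}

lemma sum_image_le_of_nonneg (hf : ∀ b, 0 ≤ f b) (s : Finset α) (g : α → β) :
    ∑ b ∈ s.image g, f b ≤ ∑ a ∈ s, f (g a) := by
  classical
  induction s using Finset.induction_on with
  | empty => simp
  | insert a s ha ih =>
    rw [Finset.image_insert, Finset.sum_insert ha]
    by_cases h : g a ∈ s.image g
    · rw [Finset.insert_eq_of_mem h]
      exact ih.trans (le_add_of_nonneg_left (hf _))
    · rw [Finset.sum_insert h]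
      exact add_le_add le_rfl ih

lemma sum_union_le_of_nonneg (hf : ∀ b, 0 ≤ f b) (s t : Finset β) :
    ∑ b ∈ s ∪ t, f b ≤ ∑ b ∈ s, f b + ∑ b ∈ t, f b := by
  rw [← Finset.sum_union_inter]
  exact le_add_of_nonneg_right (Finset.sum_nonneg fun b _ => hf b)

lemma sum_biUnion_le_of_nonneg (hf : ∀ b, 0 ≤ f b) (s : Finset α) (g : α → Finset β) :
    ∑ b ∈ s.biUnion g, f b ≤ ∑ a ∈ s, ∑ b ∈ g a, f b := by
  classical
  induction s using Finset.induction_on with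
  | empty => simp
  | insert a s ha ih =>
    rw [Finset.biUnion_insert, Finset.sum_insert ha]
    exact (sum_union_le_of_nonneg hf _ _).trans (add_le_add le_rfl ih)

end SumBounds

section Metric

variable {V : Type*}

/-- Chains of cells translate into distances. The two detour terms allow for cells that
contain no point. -/
lemma dist_le_of_chain {d' : V → V → ℝ} (hd' : IsPseudoDist d') {pos : V → ℝ} {δ : ℝ} (hδ : 0 < δ)
    (hpos' : ∀ u v, d' u v ≤ |pos u - pos v|) {m : ℕ} (cell : V → Fin m)
    (hcell : ∀ u, ((cell u : ℕ) : ℝ) * δ ≤ pos u ∧ pos u ≤ (((cell u : ℕ) : ℝ) + 1) * δ)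
    {σ : ℕ} (hσ : 0 < σ) (F : ℕ → Finset (Fin m × Fin m)) (i : ℕ)
    (hF : ∀ j < i, ∀ p ∈ F j, ∃ u v, cell u = p.1 ∧ cell v = p.2 ∧ d' u v ≤ δ * σ ^ j)
    {c c' : Fin m} {x : ℕ} (h : Chain (levelEdges (pathSteps m) F σ i) c c' x) :
    ∀ u v, d' u v ≤ 3 * δ * (|((cell u : ℕ) : ℝ) - (c : ℕ)| + x + |((cell v : ℕ) : ℝ) - (c' : ℕ)|)
      + δ := by
  have hline : ∀ u v, d' u v ≤ δ * (|((cell u : ℕ) : ℝ) - (cell v : ℕ)| + 1) := by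
    intro u v
    refine (hpos' u v).trans ?_
    obtain ⟨h1, h2⟩ := hcell u
    obtain ⟨h3, h4⟩ := hcell v
    have h5 := mul_le_mul_of_nonneg_left (le_abs_self (((cell u : ℕ) : ℝ) - (cell v : ℕ))) hδ.le
    have h6 := mul_le_mul_of_nonneg_left (neg_abs_le (((cell u : ℕ) : ℝ) - (cell v : ℕ))) hδ.le
    rw [abs_le]
    constructor <;> nlinarith
  induction h with
  | nil c x =>
    intro u v
    refine (hline u v).trans ?_
    have h1 := abs_sub_le ((cell u : ℕ) : ℝ) (c : ℕ) (cell v : ℕ)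
    rw [abs_sub_comm ((c : ℕ) : ℝ)] at h1
    have h2 := abs_nonneg (((cell u : ℕ) : ℝ) - (c : ℕ))
    have h3 := abs_nonneg (((cell v : ℕ) : ℝ) - (c : ℕ))
    have h4 : (0 : ℝ) ≤ x := Nat.cast_nonneg x
    nlinarith
  | @cons c c₁ c' l x y h1 _ h3 ih =>
    intro u v
    have hxy : (l : ℝ) + x ≤ y := by exact_mod_cast h3
    rcases levelEdges_cases h1 with ⟨h4, rfl⟩ | ⟨j, hj, h4, rfl⟩
    · refine (ih u v).trans ?_
      have h5 : |((cell u : ℕ) : ℝ) - (c₁ : ℕ)| ≤ |((cell u : ℕ) : ℝ) - (c : ℕ)| + 1 := by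
        refine (abs_sub_le _ ((c : ℕ) : ℝ) _).trans (add_le_add le_rfl ?_)
        rcases h4 with h4 | h4
        · rw [← h4]; simp
        · rw [← h4]; simp
      push_cast at hxy
      have := mul_le_mul_of_nonneg_left
        (show |((cell u : ℕ) : ℝ) - (c₁ : ℕ)| + x ≤ |((cell u : ℕ) : ℝ) - (c : ℕ)| + y by linarith)
        (by positivity : (0 : ℝ) ≤ 3 * δ)
      linarith
    · have key : ∃ u₁ v₁, cell u₁ = c ∧ cell v₁ = c₁ ∧ d' u₁ v₁ ≤ δ * σ ^ j := by
        rcases h4 with h4 | h4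
        · exact hF j hj _ h4
        · obtain ⟨a, b, ha, hb, hab⟩ := hF j hj _ h4
          exact ⟨b, a, hb, ha, by rwa [hd'.symm]⟩
      obtain ⟨u₁, v₁, hu₁, hv₁, h5⟩ := key
      have h6 := hline u u₁
      have h7 := ih v₁ v
      rw [hv₁, sub_self, abs_zero, zero_add] at h7
      rw [hu₁] at h6
      have h8 := hd'.triangle u u₁ v
      have h9 := hd'.triangle u₁ v₁ v
      have h10 : (1 : ℝ) ≤ (σ : ℝ) ^ j := by
        exact_mod_cast Nat.one_le_pow _ _ hσ
      have h11 := abs_nonneg (((cell u : ℕ) : ℝ) - (c : ℕ))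
      push_cast at hxy
      have h12 := mul_le_mul_of_nonneg_left hxy hδ.le
      have h13 := mul_nonneg hδ.le h11
      have h14 := mul_le_mul_of_nonneg_left h10 hδ.le
      nlinarith

/-- Distances along a chain of `n` pairs. -/
lemma dist_le_of_hop_chain {d' : V → V → ℝ} (hd' : IsPseudoDist d') {F : Finset (V × V)} {D : ℝ}
    (hD : 0 ≤ D) (hF : ∀ p ∈ F, d' p.1 p.2 ≤ D) {u v : V} {n : ℕ}
    (h : Chain (withEdges (fun _ _ _ => False) F 1) u v n) : d' u v ≤ n * D := by
  induction h with
  | nil u n =>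
    rw [hd'.self]
    positivity
  | @cons u v w l x y h1 _ h3 ih =>
    rcases h1 with h1 | ⟨h1, rfl⟩
    · exact h1.elim
    have huv : d' u v ≤ D := by
      rcases h1 with h1 | h1
      · exact hF _ h1
      · rw [hd'.symm]
        exact hF _ h1
    have hy : (1 : ℝ) + x ≤ y := by exact_mod_cast h3
    have := hd'.triangle u v w
    nlinarith

variable [DecidableEq V]

/-- The greedy spanner of the set `S` of pairs: pairs are considered by increasing distance, and a
pair is selected unless it is spanned by at most `t` of the pairs selected before. -/
lemma exists_greedy {d : V → V → ℝ} (hd : IsPseudoDist d) (S : Finset (V × V)) {t : ℕ}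
    (ht : 1 ≤ t) :
    ∃ F ⊆ S, IsSparse (fun _ _ _ => False) F 1 t ∧
      ∀ d' : V → V → ℝ, IsPseudoDist d' → (∀ p ∈ F, d' p.1 p.2 ≤ d p.1 p.2) →
        ∀ p ∈ S, d' p.1 p.2 ≤ t * d p.1 p.2 := by
  have ht' : (1 : ℝ) ≤ t := by exact_mod_cast ht
  induction S using Finset.induction_on_max_value (fun p : V × V => d p.1 p.2) with
  | empty => exact ⟨∅, subset_rfl, by simp [IsSparse], by simp⟩
  | insert a S ha hmax ih =>
    obtain ⟨F, hFS, hsp, hF⟩ := ih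
    have haF : a ∉ F := fun h => ha (hFS h)
    by_cases hch : Chain (withEdges (fun _ _ _ => False) F 1) a.1 a.2 t
    · refine ⟨F, hFS.trans (Finset.subset_insert _ _), hsp, fun d' hd' hdd' p hp => ?_⟩
      rcases Finset.mem_insert.1 hp with rfl | hp
      · exact dist_le_of_hop_chain hd' (hd.nonneg _ _)
          (fun e he => (hdd' e he).trans (hmax e (hFS he))) hch
      · exact hF d' hd' hdd' p hp
    · refine ⟨insert a F, Finset.insert_subset_insert _ hFS, ?_, fun d' hd' hdd' p hp => ?_⟩
      · intro p hp hc
        rcases Finset.mem_insert.1 hp with rfl | hpF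
        · rw [Finset.erase_insert haF] at hc
          exact hch hc
        · have hne : a ≠ p := fun h => haF (h ▸ hpF)
          rw [Finset.erase_insert_of_ne hne] at hc
          have hs := withEdges_symm (E := fun (_ _ : V) (_ : ℕ) => False) (fun _ _ _ h => h) F 1
          have hm : ∀ {u v x}, Chain (withEdges (fun _ _ _ => False) (F.erase p) 1) u v x →
              Chain (withEdges (fun _ _ _ => False) F 1) u v x :=
            fun h => h.mono (withEdges_mono _ (Finset.erase_subset _ _) 1)
          rcases hc.of_insert with hc | ⟨y, z, hyz, h1, h2⟩ | ⟨y, z, hyz, h1, h2⟩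
          · exact hsp p hpF hc
          · exact hch ((((hm h1).symm hs).trans ((chain_of_mem hpF).trans ((hm h2).symm hs))).le
              (by omega))
          · exact hch (((hm h2).trans (((chain_of_mem hpF).symm hs).trans (hm h1))).le (by omega))
      · rcases Finset.mem_insert.1 hp with rfl | hp
        · have := hdd' p (Finset.mem_insert_self _ _)
          have := hd.nonneg p.1 p.2
          nlinarith
        · exact hF d' hd' (fun e he => hdd' e (Finset.mem_insert_of_mem he)) p hp

/-- The greedy spanner of the short distances between few points. -/
lemma exists_pairs_of_short {d : V → V → ℝ} (hd : IsPseudoDist d) (K : Finset V) {σ : ℕ}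
    (hσ : 1 ≤ σ) (hK : K.card < 2 ^ σ) {r : ℝ} (hr : 0 ≤ r) :
    ∃ Q : Finset (V × V), ∑ p ∈ Q, d p.1 p.2 ≤ 2 * K.card * r ∧
      ∀ d' : V → V → ℝ, IsPseudoDist d' → (∀ p ∈ Q, d' p.1 p.2 ≤ d p.1 p.2) →
        ∀ x ∈ K, ∀ y ∈ K, d x y ≤ r → d' x y ≤ 2 * σ * d x y := by
  classical
  obtain ⟨F, hFS, hsp, hF⟩ := exists_greedy hd ((K ×ˢ K).filter fun p => d p.1 p.2 ≤ r)
    (t := 2 * σ) (by omega)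
  have hmem : ∀ p ∈ F, (p.1 ∈ K ∧ p.2 ∈ K) ∧ d p.1 p.2 ≤ r := fun p hp => by
    simpa [Finset.mem_filter] using hFS hp
  have hcard : F.card ≤ 2 * K.card := by
    have h := card_edges_le_of_girth (fun p : V × V => p.1) (fun p => p.2) F σ
      (fun p hp hc => hsp p hp (hc.mono ?_)) K hK
    · rwa [Finset.filter_true_of_mem fun p hp => (hmem p hp).1] at h
    · rintro u v l ⟨⟨e, he, h | h⟩, rfl⟩
      · obtain ⟨rfl, rfl⟩ := h
        exact Or.inr ⟨Or.inl he, rfl⟩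
      · obtain ⟨rfl, rfl⟩ := h
        exact Or.inr ⟨Or.inr he, rfl⟩
  refine ⟨F, ?_, fun d' hd' hdd' x hx y hy hxy => ?_⟩
  · refine (Finset.sum_le_card_nsmul _ _ r fun p hp => (hmem p hp).2).trans ?_
    rw [nsmul_eq_mul]
    exact mul_le_mul_of_nonneg_right (by exact_mod_cast hcard) hr
  · have := hF d' hd' hdd' (x, y) (by simp [hx, hy, hxy])
    simpa using this

/-- Points whose mutual distance on the line is at least the value of `f` have bounded total
value of `f`. -/
lemma sum_le_of_separated {pos f : V → ℝ} {M x : ℝ} (hM : ∀ u, f u ≤ M) (hM0 : 0 ≤ M)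
    (B : Finset V) (hB : ∀ b ∈ B, ∀ b' ∈ B, b ≠ b' → f b ≤ |pos b - pos b'|)
    (hpos : ∀ u, 0 ≤ pos u) (hx : ∀ b ∈ B, pos b ≤ x) (hx0 : 0 ≤ x) : ∑ b ∈ B, f b ≤ M + x := by
  induction B using Finset.induction_on_max_value pos generalizing x with
  | empty =>
    simp
    positivity
  | insert a B ha hmax ih =>
    rw [Finset.sum_insert ha]
    rcases B.eq_empty_or_nonempty with rfl | hne
    · simpa using (hM a).trans (le_add_of_nonneg_right hx0)
    · obtain ⟨b, hb, hbmax⟩ := Finset.exists_max_image B pos hne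
      have h1 := ih (fun b hb b' hb' => hB b (Finset.mem_insert_of_mem hb) b'
        (Finset.mem_insert_of_mem hb')) (x := pos b) hbmax (hpos b)
      have h2 := hB a (Finset.mem_insert_self _ _) b (Finset.mem_insert_of_mem hb)
        (fun h => ha (h ▸ hb))
      rw [abs_of_nonneg (sub_nonneg.2 (hmax b hb))] at h2
      have h3 := hx a (Finset.mem_insert_self _ _)
      linarith

variable [Fintype V]

/-- A light set of pairs that gives stretch `O(σ)` to all distances close to one of the scales
`δ σ ^ i`, where the line is divided into `m < 2 ^ σ` cells of length `δ`. -/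
lemma exists_pairs_of_scales {d : V → V → ℝ} (hd : IsPseudoDist d) {pos : V → ℝ} {P δ : ℝ}
    (hδ : 0 < δ) (hpos : ∀ u, 0 ≤ pos u ∧ pos u ≤ P) {m σ : ℕ} (hm : P < m * δ) (hmσ : m < 2 ^ σ)
    (hσ : 60 ≤ σ) :
    ∃ Q : Finset (V × V), ∑ p ∈ Q, d p.1 p.2 ≤ 108 * m * δ ∧
      ∀ d' : V → V → ℝ, IsPseudoDist d' → (∀ u v, d' u v ≤ |pos u - pos v|) →
        (∀ p ∈ Q, d' p.1 p.2 ≤ d p.1 p.2) →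
        ∀ i < σ, ∀ u v, d u v ≤ δ * σ ^ i → d' u v ≤ 373 * σ * (δ * σ ^ i) := by
  classical
  have hlt : ∀ u, ⌊pos u / δ⌋₊ < m := fun u => by
    rw [Nat.floor_lt (div_nonneg (hpos u).1 hδ.le), div_lt_iff₀ hδ]
    exact (hpos u).2.trans_lt hm
  set cell : V → Fin m := fun u => ⟨⌊pos u / δ⌋₊, hlt u⟩ with hcelldef
  have hcell : ∀ u, ((cell u : ℕ) : ℝ) * δ ≤ pos u ∧ pos u ≤ (((cell u : ℕ) : ℝ) + 1) * δ := by
    intro u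
    constructor
    · rw [← le_div_iff₀ hδ]
      exact Nat.floor_le (div_nonneg (hpos u).1 hδ.le)
    · rw [← div_le_iff₀ hδ]
      exact (Nat.lt_floor_add_one _).le
  obtain ⟨F, hFR, hcost, hspan⟩ := exists_light_hierarchy (pathSteps_symm m)
    (unitConnected_pathSteps m) hσ (by simpa using hmσ)
    (fun i => Finset.univ.filter fun p : Fin m × Fin m =>
      ∃ u v, cell u = p.1 ∧ cell v = p.2 ∧ d u v ≤ δ * σ ^ i)
  have hrep : ∀ (i : ℕ) (p : F i), ∃ e : V × V, cell e.1 = p.1.1 ∧ cell e.2 = p.1.2 ∧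
      d e.1 e.2 ≤ δ * σ ^ i := fun i p => by
    obtain ⟨u, v, h⟩ := (Finset.mem_filter.1 (hFR i p.2)).2
    exact ⟨(u, v), h⟩
  choose rep hrep using hrep
  set Q := (Finset.range σ).biUnion fun i => (F i).attach.image (rep i) with hQ
  have hdn : ∀ p : V × V, 0 ≤ d p.1 p.2 := fun p => hd.nonneg _ _
  refine ⟨Q, ?_, fun d' hd' hpos' hdd' i hi u v huv => ?_⟩
  · calc ∑ p ∈ Q, d p.1 p.2
        ≤ ∑ i ∈ Finset.range σ, ∑ p ∈ (F i).attach.image (rep i), d p.1 p.2 :=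
          sum_biUnion_le_of_nonneg hdn _ _
      _ ≤ ∑ i ∈ Finset.range σ, ((F i).card * σ ^ i : ℕ) * δ := by
          refine Finset.sum_le_sum fun i _ => (sum_image_le_of_nonneg hdn _ _).trans ?_
          refine (Finset.sum_le_card_nsmul _ _ (δ * σ ^ i) fun p _ => (hrep i p).2.2).trans
            (le_of_eq ?_)
          rw [Finset.card_attach, nsmul_eq_mul]
          push_cast
          ring
      _ = ((∑ i ∈ Finset.range σ, (F i).card * σ ^ i : ℕ) : ℝ) * δ := by
          rw [← Finset.sum_mul]
          push_cast
          rfl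
      _ ≤ ((108 * m : ℕ) : ℝ) * δ := by
          refine mul_le_mul_of_nonneg_right (Nat.cast_le.2 ?_) hδ.le
          simpa using hcost
      _ = 108 * m * δ := by push_cast; ring
  · have hch := hspan i hi (cell u, cell v)
      (Finset.mem_filter.2 ⟨Finset.mem_univ _, u, v, rfl, rfl, huv⟩)
    have h := dist_le_of_chain hd' hδ hpos' cell hcell (by omega) F σ (fun j hj p hp =>
      ⟨_, _, (hrep j ⟨p, hp⟩).1, (hrep j ⟨p, hp⟩).2.1, (hdd' _ (Finset.mem_biUnion.2
        ⟨j, Finset.mem_range.2 hj, Finset.mem_image.2 ⟨⟨p, hp⟩, Finset.mem_attach _ _, rfl⟩⟩)).trans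
          (hrep j ⟨p, hp⟩).2.2⟩) hch u v
    simp only [sub_self, abs_zero, zero_add, add_zero] at h
    push_cast at h
    have h1 : (1 : ℝ) ≤ (σ : ℝ) ^ i := one_le_pow₀ (by exact_mod_cast (by omega : 1 ≤ σ))
    have h2 : (1 : ℝ) ≤ σ := by exact_mod_cast (by omega : 1 ≤ σ)
    have h3 : (1 : ℝ) ≤ σ * σ ^ i := one_le_mul_of_one_le_of_one_le h2 h1
    nlinarith

/-- Break points for a shallow-light tree: points are considered by increasing value of `f`, and a
point `u` is selected if no break point is within distance `f u` of it on the line. -/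
lemma exists_break_points {pos f : V → ℝ} {P M : ℝ} (hpos : ∀ u, 0 ≤ pos u ∧ pos u ≤ P)
    (hf : ∀ u, 0 ≤ f u ∧ f u ≤ M) (hM : 0 ≤ M) (hP : 0 ≤ P) :
    ∃ B : Finset V, ∑ b ∈ B, f b ≤ M + P ∧
      ∀ u, ∃ b ∈ B, |pos u - pos b| ≤ f u ∧ f b ≤ f u := by
  have main : ∀ S : Finset V, ∃ B ⊆ S,
      (∀ b ∈ B, ∀ b' ∈ B, b ≠ b' → f b ≤ |pos b - pos b'|) ∧
      ∀ u ∈ S, ∃ b ∈ B, |pos u - pos b| ≤ f u ∧ f b ≤ f u := by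
    intro S
    induction S using Finset.induction_on_max_value f with
    | empty => exact ⟨∅, by simp⟩
    | insert a S ha hmax ih =>
      obtain ⟨B, hBS, hsep, hcov⟩ := ih
      by_cases h : ∃ b ∈ B, |pos a - pos b| ≤ f a
      · obtain ⟨b, hb, hab⟩ := h
        refine ⟨B, hBS.trans (Finset.subset_insert _ _), hsep, fun u hu => ?_⟩
        rcases Finset.mem_insert.1 hu with rfl | hu
        · exact ⟨b, hb, hab, hmax b (hBS hb)⟩
        · exact hcov u hu
      · push Not at h
        refine ⟨insert a B, Finset.insert_subset_insert _ hBS, ?_, fun u hu => ?_⟩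
        · intro b hb b' hb' hne
          rcases Finset.mem_insert.1 hb with h1 | h1 <;> rcases Finset.mem_insert.1 hb' with h2 | h2
          · exact absurd (h1.trans h2.symm) hne
          · rw [h1]
            exact (h b' h2).le
          · rw [h2, abs_sub_comm]
            exact (hmax b (hBS h1)).trans (h b h1).le
          · exact hsep b h1 b' h2 hne
        · rcases Finset.mem_insert.1 hu with rfl | hu
          · exact ⟨u, Finset.mem_insert_self _ _, by simpa using (hf u).1, le_rfl⟩
          · obtain ⟨b, hb, h1⟩ := hcov u hu
            exact ⟨b, Finset.mem_insert_of_mem hb, h1⟩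
  obtain ⟨B, -, hsep, hcov⟩ := main Finset.univ
  exact ⟨B, sum_le_of_separated (fun u => (hf u).2) hM B hsep (fun u => (hpos u).1)
    (fun b _ => (hpos b).2) hP, fun u => hcov u (Finset.mem_univ u)⟩

/-- A shallow-light forest: a light set of pairs that keeps the distances to the set `K`. -/
lemma exists_pairs_of_terminals {d : V → V → ℝ} (hd : IsPseudoDist d) {pos : V → ℝ} {P : ℝ}
    (hP : 0 ≤ P) (hpos : ∀ u, 0 ≤ pos u ∧ pos u ≤ P) (hdpos : ∀ u v, d u v ≤ |pos u - pos v|)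
    (K : Finset V) (hK : K.Nonempty) :
    ∃ Q : Finset (V × V), ∑ p ∈ Q, d p.1 p.2 ≤ 2 * P ∧
      ∀ d' : V → V → ℝ, IsPseudoDist d' → (∀ u v, d' u v ≤ |pos u - pos v|) →
        (∀ p ∈ Q, d' p.1 p.2 ≤ d p.1 p.2) →
        ∀ u, ∀ x ∈ K, ∃ z ∈ K, d' u z ≤ 2 * d u x ∧ d u z ≤ 2 * d u x := by
  classical
  have hnear : ∀ u, ∃ z ∈ K, ∀ x ∈ K, d u z ≤ d u x := fun u =>
    Finset.exists_min_image K (d u) hK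
  choose near hnearK hnear using hnear
  have hlip : ∀ u v, |pos u - pos v| ≤ P := fun u v => by
    rw [abs_le]
    constructor <;> linarith [(hpos u).1, (hpos u).2, (hpos v).1, (hpos v).2]
  obtain ⟨B, hBsum, hB⟩ := exists_break_points (f := fun u => d u (near u)) hpos
    (fun u => ⟨hd.nonneg _ _, (hdpos _ _).trans (hlip _ _)⟩) hP hP
  refine ⟨B.image fun b => (b, near b), ?_, fun d' hd' hpos' hdd' u x hx => ?_⟩
  · refine (sum_image_le_of_nonneg (f := fun p : V × V => d p.1 p.2)
      (fun p => hd.nonneg _ _) _ _).trans ?_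
    simpa [two_mul] using hBsum
  · obtain ⟨b, hb, h1, h2⟩ := hB u
    have h3 := hdd' _ (Finset.mem_image_of_mem (fun b => (b, near b)) hb)
    have h4 := hpos' u b
    have h5 := hd'.triangle u b (near b)
    have h6 := hnear u x hx
    have h7 := hd.triangle u b (near b)
    have h8 := hdpos u b
    simp only at h3
    exact ⟨near b, hnearK b, by linarith, by linarith⟩

/-- The main light set of pairs: it keeps the distances from at most `2 ^ (σ - 2)` terminals to all
points up to a factor `O(σ)`, and its total length is `O(log σ)` times the length of the line.
Distances at least `δ = P / 2 ^ (σ - 2)` are treated in `A = log₂ σ` classes of scales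
`2 ^ a δ σ ^ i`; for shorter distances, a point is first connected to a nearby terminal. -/
theorem exists_light_pairs {d : V → V → ℝ} (hd : IsPseudoDist d) {pos : V → ℝ} {P : ℝ}
    (hP : 0 ≤ P) (hpos : ∀ u, 0 ≤ pos u ∧ pos u ≤ P) (hdpos : ∀ u v, d u v ≤ |pos u - pos v|)
    (K : Finset V) (hK : K.Nonempty) {A : ℕ} (hA : 6 ≤ A) (hKA : K.card ≤ 2 ^ (2 ^ A - 2)) :
    ∃ Q : Finset (V × V), ∑ p ∈ Q, d p.1 p.2 ≤ 224 * A * P ∧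
      ∀ d' : V → V → ℝ, IsPseudoDist d' → (∀ u v, d' u v ≤ |pos u - pos v|) →
        (∀ p ∈ Q, d' p.1 p.2 ≤ d p.1 p.2) →
        ∀ x ∈ K, ∀ y, d' x y ≤ 746 * 2 ^ A * d x y := by
  classical
  have hlip : ∀ u v, |pos u - pos v| ≤ P := fun u v => by
    rw [abs_le]
    constructor <;> linarith [(hpos u).1, (hpos u).2, (hpos v).1, (hpos v).2]
  rcases hP.eq_or_lt with rfl | hP'
  · refine ⟨∅, by simp, fun d' hd' hpos' _ x _ y => ?_⟩
    refine ((hpos' x y).trans (hlip x y)).trans ?_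
    have := hd.nonneg x y
    positivity
  set σ := 2 ^ A with hσdef
  have hσ : 60 ≤ σ := by
    have : 2 ^ 6 ≤ 2 ^ A := Nat.pow_le_pow_right (by norm_num) hA
    omega
  set δ : ℝ := P / 2 ^ (σ - 2) with hδdef
  have hδ : 0 < δ := by positivity
  have hδP : 2 ^ (σ - 2) * δ = P := by rw [hδdef]; field_simp
  have hσpow : σ ≤ 2 ^ (σ - 2) := by
    have h1 : σ - 3 < 2 ^ (σ - 3) := Nat.lt_two_pow_self
    have h2 : 2 ^ (σ - 2) = 2 ^ (σ - 3) * 2 := by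
      rw [← pow_succ]
      congr 1
      omega
    omega
  have hclass : ∀ a ∈ Finset.range A, ∃ Q : Finset (V × V), ∑ p ∈ Q, d p.1 p.2 ≤ 216 * P ∧
      ∀ d' : V → V → ℝ, IsPseudoDist d' → (∀ u v, d' u v ≤ |pos u - pos v|) →
        (∀ p ∈ Q, d' p.1 p.2 ≤ d p.1 p.2) →
        ∀ i < σ, ∀ u v, d u v ≤ 2 ^ a * δ * σ ^ i → d' u v ≤ 373 * σ * (2 ^ a * δ * σ ^ i) := by
    intro a ha
    rw [Finset.mem_range] at ha
    have hδa : 0 < 2 ^ a * δ := by positivity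
    have hδa1 : δ ≤ 2 ^ a * δ := le_mul_of_one_le_left hδ.le (one_le_pow₀ (by norm_num))
    have hδaP : 2 ^ a * δ ≤ P := by
      rw [← hδP]
      refine mul_le_mul_of_nonneg_right ?_ hδ.le
      have : 2 ^ a ≤ 2 ^ (σ - 2) := (Nat.pow_le_pow_right (by norm_num) ha.le).trans hσpow
      exact_mod_cast this
    have hfl : (⌊P / (2 ^ a * δ)⌋₊ : ℝ) ≤ P / (2 ^ a * δ) := Nat.floor_le (by positivity)
    have hm : P < (⌊P / (2 ^ a * δ)⌋₊ + 1 : ℕ) * (2 ^ a * δ) := by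
      rw [← div_lt_iff₀ hδa]
      exact_mod_cast Nat.lt_floor_add_one _
    have hmσ : ⌊P / (2 ^ a * δ)⌋₊ + 1 < 2 ^ σ := by
      have h1 : ⌊P / (2 ^ a * δ)⌋₊ ≤ 2 ^ (σ - 2) := by
        refine Nat.floor_le_of_le ?_
        rw [div_le_iff₀ hδa]
        push_cast
        rw [← hδP]
        gcongr
      have h2 : 2 ^ σ = 2 ^ (σ - 2) * 4 := by
        rw [show (4 : ℕ) = 2 ^ 2 by norm_num, ← pow_add]
        congr 1
        omega
      have h3 : 0 < 2 ^ (σ - 2) := by positivity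
      omega
    obtain ⟨Q, hQ, hQ'⟩ := exists_pairs_of_scales hd hδa hpos hm (σ := σ) hmσ hσ
    refine ⟨Q, hQ.trans ?_, hQ'⟩
    have : (⌊P / (2 ^ a * δ)⌋₊ : ℝ) * (2 ^ a * δ) ≤ P := by
      rwa [← le_div_iff₀ hδa]
    push_cast
    linarith
  choose! Qc hQc hQc' using hclass
  have hKσ : K.card < 2 ^ σ := lt_of_le_of_lt hKA
    (Nat.pow_lt_pow_right (by norm_num) (by omega))
  obtain ⟨Qs, hQs, hQs'⟩ := exists_pairs_of_short hd K (by omega) hKσ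
    (r := 3 * δ) (by positivity)
  obtain ⟨Qt, hQt, hQt'⟩ := exists_pairs_of_terminals hd hP hpos hdpos K hK
  have hdn : ∀ p : V × V, 0 ≤ d p.1 p.2 := fun p => hd.nonneg _ _
  refine ⟨((Finset.range A).biUnion Qc ∪ Qs) ∪ Qt, ?_, fun d' hd' hpos' hdd' x hx y => ?_⟩
  · have h1 := sum_union_le_of_nonneg hdn ((Finset.range A).biUnion Qc ∪ Qs) Qt
    have h2 := sum_union_le_of_nonneg hdn ((Finset.range A).biUnion Qc) Qs
    have h3 := sum_biUnion_le_of_nonneg hdn (Finset.range A) Qc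
    have h4 : ∑ a ∈ Finset.range A, ∑ p ∈ Qc a, d p.1 p.2 ≤ A * (216 * P) := by
      refine (Finset.sum_le_card_nsmul _ _ _ hQc).trans (le_of_eq ?_)
      simp
    have h5 : 2 * (K.card : ℝ) * (3 * δ) ≤ 6 * P := by
      have : (K.card : ℝ) ≤ 2 ^ (σ - 2) := by exact_mod_cast hKA
      rw [← hδP]
      nlinarith
    have h6 : (6 : ℝ) ≤ A := by exact_mod_cast hA
    nlinarith
  · have hdc : ∀ a ∈ Finset.range A, ∀ p ∈ Qc a, d' p.1 p.2 ≤ d p.1 p.2 := fun a ha p hp =>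
      hdd' p (Finset.mem_union_left _ (Finset.mem_union_left _
        (Finset.mem_biUnion.2 ⟨a, ha, hp⟩)))
    have hds : ∀ p ∈ Qs, d' p.1 p.2 ≤ d p.1 p.2 := fun p hp =>
      hdd' p (Finset.mem_union_left _ (Finset.mem_union_right _ hp))
    have hdt : ∀ p ∈ Qt, d' p.1 p.2 ≤ d p.1 p.2 := fun p hp =>
      hdd' p (Finset.mem_union_right _ hp)
    have hσcast : ((2 : ℝ) ^ A) = σ := by rw [hσdef]; push_cast; rfl
    rw [hσcast]
    have hσ1 : (60 : ℝ) ≤ σ := by exact_mod_cast hσ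
    have hxy := hd.nonneg x y
    rcases le_total δ (d x y) with hlarge | hsmall
    · -- the least power of two with `d x y ≤ 2 ^ j * δ`
      have hex : ∃ j, d x y ≤ 2 ^ j * δ :=
        ⟨σ - 2, by rw [hδP]; exact (hdpos x y).trans (hlip x y)⟩
      set j := Nat.find hex with hj
      have hj1 : d x y ≤ 2 ^ j * δ := Nat.find_spec hex
      have hj2 : j ≤ σ - 2 := Nat.find_min' hex (by rw [hδP]; exact (hdpos x y).trans (hlip x y))
      have hj3 : 2 ^ j * δ ≤ 2 * d x y := by
        rcases Nat.eq_zero_or_pos j with h0 | h0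
        · rw [h0, pow_zero, one_mul]
          linarith
        · have := Nat.find_min hex (m := j - 1) (by omega)
          rw [not_le] at this
          have h2 : (2 : ℝ) ^ j = 2 * 2 ^ (j - 1) := by
            rw [← pow_succ']
            congr 1
            omega
          rw [h2]
          linarith
      have hmod : j % A ∈ Finset.range A := Finset.mem_range.2 (Nat.mod_lt _ (by omega))
      have hpow : (2 : ℝ) ^ (j % A) * δ * σ ^ (j / A) = 2 ^ j * δ := by
        rw [← hσcast, ← pow_mul, mul_right_comm, ← pow_add, Nat.mod_add_div]
      have hdiv : j / A < σ := by
        have := Nat.div_le_self j A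
        omega
      have h := hQc' _ hmod d' hd' hpos' (hdc _ hmod) (j / A) hdiv x y (by rw [hpow]; exact hj1)
      rw [hpow] at h
      nlinarith
    · obtain ⟨z, hz, h1, h2⟩ := hQt' d' hd' hpos' hdt y x hx
      rw [hd.symm y x] at h1 h2
      have h3 := hd.triangle x y z
      have h4 := hQs' d' hd' hds x hx z hz (by linarith)
      have h5 := hd'.triangle x z y
      rw [hd'.symm z y] at h5
      have h6 : 2 * (σ : ℝ) * d x z ≤ 2 * σ * (3 * d x y) :=
        mul_le_mul_of_nonneg_left (by linarith) (by linarith)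
      nlinarith

end Metric

/-! ### Shortest-path distances in weighted graphs -/

section Graph

variable {V : Type*} {G H T : SimpleGraph V} (w : Sym2 V → ℝ≥0)

lemma walkWeight_append {u v x : V} (p : G.Walk u v) (q : G.Walk v x) :
    walkWeight w (p.append q) = walkWeight w p + walkWeight w q := by
  simp [walkWeight, SimpleGraph.Walk.edges_append]

lemma walkWeight_reverse {u v : V} (p : G.Walk u v) :
    walkWeight w p.reverse = walkWeight w p := by
  simp [walkWeight, SimpleGraph.Walk.edges_reverse, List.sum_reverse]

lemma walkWeight_ne_top {u v : V} (p : G.Walk u v) : walkWeight w p ≠ ∞ := by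
  unfold walkWeight
  induction p.edges with
  | nil => simp
  | cons e l ih => simpa using ih

lemma walkWeight_bypass_le [DecidableEq V] {u v : V} (p : G.Walk u v) :
    walkWeight w p.bypass ≤ walkWeight w p :=
  (p.edges_bypass_sublist_edges.map _).sum_le_sum fun _ _ => zero_le

/-- The shortest-path distance is attained. -/
lemma exists_walkWeight_eq_wdist [Fintype V] (hG : G.Connected) (u v : V) :
    ∃ p : G.Walk u v, walkWeight w p = wdist G w u v := by
  classical
  obtain ⟨p₀⟩ := hG.preconnected u v
  have : Nonempty (G.Path u v) := ⟨p₀.toPath⟩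
  obtain ⟨p, hp⟩ := Finite.exists_min fun p : G.Path u v => walkWeight w p.1
  refine ⟨p.1, le_antisymm (le_iInf fun q => ?_) (iInf_le _ _)⟩
  exact (hp q.toPath).trans (walkWeight_bypass_le w q)

lemma wdist_ne_top [Fintype V] (hG : G.Connected) (u v : V) : wdist G w u v ≠ ∞ := by
  obtain ⟨p, hp⟩ := exists_walkWeight_eq_wdist w hG u v
  exact hp ▸ walkWeight_ne_top w p

lemma wdist_self (u : V) : wdist G w u u = 0 :=
  le_antisymm ((iInf_le _ SimpleGraph.Walk.nil).trans (by simp [walkWeight])) zero_le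

lemma wdist_comm (u v : V) : wdist G w u v = wdist G w v u := by
  have h : ∀ u v, wdist G w u v ≤ wdist G w v u := fun u v =>
    le_iInf fun p => (iInf_le _ p.reverse).trans (walkWeight_reverse w p).le
  exact le_antisymm (h u v) (h v u)

lemma wdist_triangle [Fintype V] (hG : G.Connected) (u v x : V) :
    wdist G w u x ≤ wdist G w u v + wdist G w v x := by
  obtain ⟨p, hp⟩ := exists_walkWeight_eq_wdist w hG u v
  obtain ⟨q, hq⟩ := exists_walkWeight_eq_wdist w hG v x
  rw [← hp, ← hq, ← walkWeight_append]
  exact iInf_le _ _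

lemma wdist_le_of_adj {u v : V} (h : G.Adj u v) : wdist G w u v ≤ w s(u, v) :=
  (iInf_le _ h.toWalk).trans (by simp [walkWeight])

lemma wdist_anti (h : T ≤ H) (u v : V) : wdist H w u v ≤ wdist T w u v :=
  le_iInf fun p => (iInf_le _ (p.mapLe h)).trans
    (by simp [walkWeight])

lemma isPseudoDist_wdist [Fintype V] (hG : G.Connected) :
    IsPseudoDist fun u v => (wdist G w u v).toReal where
  self u := by simp [wdist_self]
  symm u v := by rw [wdist_comm]
  triangle u v x := by
    rw [← ENNReal.toReal_add (wdist_ne_top w hG u v) (wdist_ne_top w hG v x)]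
    exact ENNReal.toReal_mono (ENNReal.add_ne_top.2
      ⟨wdist_ne_top w hG u v, wdist_ne_top w hG v x⟩) (wdist_triangle w hG u v x)

/-! ### Placing the vertices of a tree on a line -/

/-- The vertices of a connected graph can be placed on a line of length at most twice the weight of
the graph, such that distances on the line are at least those in the graph. Vertices are
added one at a time: a new vertex `b` joined to `a` by an edge of length `x` is placed at distance
`x` to the right of `a`, and everything to the right of `a` moves by `2 x`. -/
lemma exists_line_placement [Fintype V] (hT : T.Connected) {d : V → V → ℝ} (hd : IsPseudoDist d)
    (hadj : ∀ a b, T.Adj a b → d a b ≤ w s(a, b)) :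
    ∃ pos : V → ℝ, (∀ u, 0 ≤ pos u ∧ pos u ≤ 2 * (weight T w).toReal) ∧
      ∀ u v, d u v ≤ |pos u - pos v| := by
  classical
  have main : ∀ n, 1 ≤ n → n ≤ Fintype.card V → ∃ (S : Finset V) (F : Finset (Sym2 V)) (pos : V → ℝ),
      S.card = n ∧ F ⊆ T.edgeFinset ∧ (∀ e ∈ F, ∀ v ∈ e, v ∈ S) ∧
      (∀ u ∈ S, 0 ≤ pos u ∧ pos u ≤ 2 * ∑ e ∈ F, (w e : ℝ)) ∧
      ∀ u ∈ S, ∀ v ∈ S, d u v ≤ |pos u - pos v| := by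
    intro n hn
    induction n, hn using Nat.le_induction with
    | base =>
      intro _
      obtain ⟨a⟩ := hT.nonempty
      refine ⟨{a}, ∅, fun _ => 0, by simp, by simp, by simp, by simp, ?_⟩
      simp [hd.self]
    | succ n hn ih =>
      intro hn'
      obtain ⟨S, F, pos, hS, hF, hFS, hpos, hdist⟩ := ih (by omega)
      obtain ⟨a₀, ha₀⟩ : S.Nonempty := Finset.card_pos.1 (by omega)
      obtain ⟨b₀, hb₀⟩ : ∃ b, b ∉ S := by
        by_contra hno
        push Not at hno
        have := Finset.card_le_card (fun x _ => hno x : Finset.univ ⊆ S)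
        rw [Finset.card_univ] at this
        omega
      obtain ⟨p⟩ := hT.preconnected a₀ b₀
      obtain ⟨⟨⟨a, b⟩, hab⟩, -, ha, hb⟩ := p.exists_boundary_dart (S : Set V)
        (Finset.mem_coe.2 ha₀) (fun h => hb₀ (Finset.mem_coe.1 h))
      replace ha : a ∈ S := Finset.mem_coe.1 ha
      replace hb : b ∉ S := fun h => hb (Finset.mem_coe.2 h)
      set x : ℝ := (w s(a, b) : ℝ) with hx
      have hx0 : 0 ≤ x := NNReal.coe_nonneg _
      have hnew : s(a, b) ∉ F := fun h => hb (hFS _ h b (Sym2.mem_mk_right a b))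
      set pos' : V → ℝ := fun u => if u = b then pos a + x else
        if pos u ≤ pos a then pos u else pos u + 2 * x with hpos'
      have hposb : pos' b = pos a + x := by simp [hpos']
      have hposS : ∀ u ∈ S, pos' u = if pos u ≤ pos a then pos u else pos u + 2 * x := by
        intro u hu
        have : u ≠ b := fun h => hb (h ▸ hu)
        simp [hpos', this]
      have hub : ∀ u ∈ S, d u b ≤ |pos' u - pos' b| := by
        intro u hu
        have h1 := hd.triangle u a b
        have h2 := hadj a b hab
        have h3 := hdist u hu a ha
        rw [hposb, hposS u hu]
        by_cases h : pos u ≤ pos a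
        · rw [abs_of_nonpos (by linarith)] at h3
          rw [if_pos h, abs_of_nonpos (by linarith)]
          linarith
        · rw [abs_of_nonneg (by linarith)] at h3
          rw [if_neg h, abs_of_nonneg (by linarith)]
          linarith
      refine ⟨insert b S, insert s(a, b) F, pos', by rw [Finset.card_insert_of_notMem hb, hS],
        ?_, ?_, ?_, ?_⟩
      · refine Finset.insert_subset ?_ hF
        simpa using hab
      · intro e he v hv
        rcases Finset.mem_insert.1 he with rfl | he
        · rcases Sym2.mem_iff.1 hv with rfl | rfl
          · exact Finset.mem_insert_of_mem ha
          · exact Finset.mem_insert_self _ _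
        · exact Finset.mem_insert_of_mem (hFS e he v hv)
      · intro u hu
        rw [Finset.sum_insert hnew]
        rcases Finset.mem_insert.1 hu with rfl | hu
        · rw [hposb]
          constructor <;> linarith [(hpos a ha).1, (hpos a ha).2]
        · rw [hposS u hu]
          split_ifs <;> constructor <;> linarith [(hpos u hu).1, (hpos u hu).2]
      · intro u hu v hv
        rcases Finset.mem_insert.1 hu with h1 | h1 <;> rcases Finset.mem_insert.1 hv with h2 | h2
        · rw [h1, h2, hd.self]
          exact abs_nonneg _
        · rw [h1, hd.symm, abs_sub_comm]
          exact hub v h2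
        · rw [h2]
          exact hub u h1
        · refine (hdist u h1 v h2).trans ?_
          rw [hposS u h1, hposS v h2]
          split_ifs
          · exact le_rfl
          · rw [abs_of_nonpos (by linarith), abs_of_nonpos (by linarith)]
            linarith
          · rw [abs_of_nonneg (by linarith), abs_of_nonneg (by linarith)]
            linarith
          · rw [add_sub_add_right_eq_sub]
  have := hT.nonempty
  obtain ⟨S, F, pos, hS, hF, -, hpos, hdist⟩ := main _ Fintype.card_pos le_rfl
  have hSu : ∀ u, u ∈ S := by
    rw [← Finset.eq_univ_iff_forall, ← Finset.card_eq_iff_eq_univ]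
    exact hS
  have hle : ∑ e ∈ F, (w e : ℝ) ≤ (weight T w).toReal := by
    rw [weight, ENNReal.toReal_sum (fun _ _ => ENNReal.coe_ne_top)]
    simp only [ENNReal.coe_toReal]
    refine Finset.sum_le_sum_of_subset_of_nonneg (fun e he => ?_) fun _ _ _ => NNReal.coe_nonneg _
    simpa using hF he
  exact ⟨pos, fun u => ⟨(hpos u (hSu u)).1, (hpos u (hSu u)).2.trans (by linarith)⟩,
    fun u v => hdist u (hSu u) v (hSu v)⟩

/-! ### Spanners with few terminals -/

open Classical in
/-- The total weight of the edges of `H` that do not belong to `T`. -/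
noncomputable def extraWeight [Fintype V] (T H : SimpleGraph V) (w : Sym2 V → ℝ≥0) : ℝ≥0∞ :=
  ∑ e ∈ Finset.univ.filter (fun e => e ∈ H.edgeSet ∧ e ∉ T.edgeSet), (w e : ℝ≥0∞)

lemma weight_le_add_extraWeight [Fintype V] (T H : SimpleGraph V) :
    weight H w ≤ weight T w + extraWeight T H w := by
  classical
  unfold weight extraWeight
  refine le_trans (Finset.sum_le_sum_of_subset ?_) (Finset.sum_union_inter.le.trans' le_self_add)
  intro e he
  by_cases h : e ∈ T.edgeSet <;> simp_all

/-- A set of pairs of vertices of `G` is turned into a graph by adding shortest paths to `T`. -/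
lemma exists_graph_of_pairs [Fintype V] (hG : G.Connected) (hTG : T ≤ G) (Q : Finset (V × V)) :
    ∃ H, T ≤ H ∧ H ≤ G ∧ extraWeight T H w ≤ ∑ p ∈ Q, wdist G w p.1 p.2 ∧
      ∀ p ∈ Q, wdist H w p.1 p.2 ≤ wdist G w p.1 p.2 := by
  classical
  have hsp : ∀ p : V × V, ∃ q : G.Walk p.1 p.2, walkWeight w q = wdist G w p.1 p.2 := fun p =>
    exists_walkWeight_eq_wdist w hG _ _
  choose sp hsp using hsp
  obtain ⟨H, hH⟩ : ∃ H, H = T ⊔ SimpleGraph.fromEdgeSet {e | ∃ p ∈ Q, e ∈ (sp p).edges} :=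
    ⟨_, rfl⟩
  have hmem : ∀ p ∈ Q, ∀ e ∈ (sp p).edges, e ∈ H.edgeSet := by
    intro p hp e he
    rw [hH, SimpleGraph.edgeSet_sup, SimpleGraph.edgeSet_fromEdgeSet]
    exact Or.inr ⟨⟨p, hp, he⟩, G.not_isDiag_of_mem_edgeSet ((sp p).edges_subset_edgeSet he)⟩
  refine ⟨H, hH ▸ le_sup_left, hH ▸ sup_le hTG ?_, ?_, fun p hp => ?_⟩
  · rw [← SimpleGraph.edgeSet_subset_edgeSet, SimpleGraph.edgeSet_fromEdgeSet]
    rintro e ⟨⟨p, -, he⟩, -⟩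
    exact (sp p).edges_subset_edgeSet he
  · rw [extraWeight]
    refine (Finset.sum_le_sum_of_subset (t := Q.biUnion fun p => (sp p).edges.toFinset) ?_).trans ?_
    · intro e he
      obtain ⟨-, h1, h2⟩ := Finset.mem_filter.1 he
      rw [hH, SimpleGraph.edgeSet_sup, SimpleGraph.edgeSet_fromEdgeSet] at h1
      obtain ⟨⟨p, hp, hep⟩, -⟩ := h1.resolve_left h2
      exact Finset.mem_biUnion.2 ⟨p, hp, List.mem_toFinset.2 hep⟩
    refine (sum_biUnion_le_of_nonneg (f := fun e => (w e : ℝ≥0∞)) (fun _ => zero_le) _ _).trans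
      (Finset.sum_le_sum fun p _ => ?_)
    have hdedup : (sp p).edges.toFinset = (sp p).edges.dedup.toFinset := by ext; simp
    rw [← hsp p, walkWeight, hdedup, List.sum_toFinset _ (List.nodup_dedup _)]
    exact ((List.dedup_sublist (sp p).edges).map fun e => (w e : ℝ≥0∞)).sum_le_sum
      fun _ _ => zero_le
  · rw [← hsp p]
    refine (iInf_le _ ((sp p).transfer H (hmem p hp))).trans ?_
    simp [walkWeight, SimpleGraph.Walk.edges_transfer]

/-- Given a connected subgraph `T` of `G` and a set `K` of at most `2 ^ (2 ^ A - 2)` vertices, there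
is a spanner whose weight outside of `T` is `O(A)` times the weight of `T`, and in which all
pairs that meet `K` have distortion `O(2 ^ A)`. -/
lemma exists_terminal_spanner [Fintype V] (hG : G.Connected) (hTG : T ≤ G) (hT : T.Connected)
    (K : Finset V) (hK : K.Nonempty) {A : ℕ} (hA : 6 ≤ A) (hKA : K.card ≤ 2 ^ (2 ^ A - 2)) :
    ∃ H, T ≤ H ∧ H ≤ G ∧ extraWeight T H w ≤ ENNReal.ofReal (448 * A) * weight T w ∧
      ∀ x ∈ K, ∀ y, wdist H w x y ≤ ENNReal.ofReal (746 * 2 ^ A) * wdist G w x y := by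
  classical
  obtain ⟨pos, hpos, hTpos⟩ := exists_line_placement w hT (isPseudoDist_wdist w hT)
    (fun a b hab => ENNReal.toReal_mono ENNReal.coe_ne_top (wdist_le_of_adj w hab))
  have hWT : weight T w ≠ ∞ := by
    rw [weight]
    exact ENNReal.sum_ne_top.2 fun _ _ => ENNReal.coe_ne_top
  have hle : ∀ H, T ≤ H → ∀ u v, (wdist H w u v).toReal ≤ |pos u - pos v| := fun H hTH u v =>
    (ENNReal.toReal_mono (wdist_ne_top w hT u v) (wdist_anti w hTH u v)).trans (hTpos u v)
  obtain ⟨Q, hQ, hspan⟩ := exists_light_pairs (isPseudoDist_wdist w hG) (by positivity) hpos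
    (hle G hTG) K hK hA hKA
  obtain ⟨H, hTH, hHG, hext, hHQ⟩ := exists_graph_of_pairs w hG hTG Q
  have hHc : H.Connected := hT.mono hTH
  refine ⟨H, hTH, hHG, hext.trans ?_, fun x hx y => ?_⟩
  · rw [← ENNReal.ofReal_toReal hWT, ← ENNReal.ofReal_mul (by positivity)]
    refine ENNReal.le_ofReal_iff_toReal_le (ENNReal.sum_ne_top.2 fun p _ => wdist_ne_top w hG _ _)
      (by positivity) |>.2 ?_
    rw [ENNReal.toReal_sum fun p _ => wdist_ne_top w hG _ _]
    linarith
  · have h := hspan _ (isPseudoDist_wdist w hHc) (hle H hTH) (fun p hp =>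
      ENNReal.toReal_mono (wdist_ne_top w hG _ _) (hHQ p hp)) x hx y
    rw [← ENNReal.ofReal_toReal (wdist_ne_top w hHc x y),
      ← ENNReal.ofReal_toReal (wdist_ne_top w hG x y), ← ENNReal.ofReal_mul (by positivity)]
    exact ENNReal.ofReal_le_ofReal h

/-- Stretching all edges outside of `T` by a factor `M` before applying the previous
construction reduces the additional weight by the factor `M`, at the expense of the distortion. -/
lemma exists_terminal_spanner_scaled [Fintype V] (hG : G.Connected) (hTG : T ≤ G)
    (hT : T.Connected) (K : Finset V) (hK : K.Nonempty) {A : ℕ} (hA : 6 ≤ A)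
    (hKA : K.card ≤ 2 ^ (2 ^ A - 2)) {M : ℝ≥0} (hM : 1 ≤ M) :
    ∃ H, T ≤ H ∧ H ≤ G ∧ extraWeight T H w ≤ ENNReal.ofReal (448 * A / M) * weight T w ∧
      ∀ x ∈ K, ∀ y, wdist H w x y ≤ ENNReal.ofReal (746 * 2 ^ A * M) * wdist G w x y := by
  classical
  set w' : Sym2 V → ℝ≥0 := fun e => if e ∈ T.edgeSet then w e else M * w e with hw'
  obtain ⟨H, hTH, hHG, hext, hspan⟩ := exists_terminal_spanner w' hG hTG hT K hK hA hKA
  have hMpos : 0 < M := lt_of_lt_of_le one_pos hM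
  have hle1 : ∀ e, w e ≤ w' e := fun e => by
    simp only [hw']
    split_ifs
    · exact le_rfl
    · exact le_mul_of_one_le_left' hM
  have hle2 : ∀ e, w' e ≤ M * w e := fun e => by
    simp only [hw']
    split_ifs
    · exact le_mul_of_one_le_left' hM
    · exact le_rfl
  have hwT : weight T w' = weight T w := by
    refine Finset.sum_congr rfl fun e he => ?_
    have : e ∈ T.edgeSet := by simpa using he
    simp [hw', this]
  have hwH : extraWeight T H w' = M * extraWeight T H w := by
    rw [extraWeight, extraWeight, Finset.mul_sum]
    refine Finset.sum_congr rfl fun e he => ?_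
    have : e ∉ T.edgeSet := (Finset.mem_filter.1 he).2.2
    simp [hw', this]
  have hd1 : ∀ u v, wdist H w u v ≤ wdist H w' u v := fun u v =>
    iInf_mono fun p => List.sum_le_sum fun e _ => ENNReal.coe_le_coe.2 (hle1 e)
  have hd2 : ∀ u v, wdist G w' u v ≤ M * wdist G w u v := fun u v => by
    obtain ⟨p, hp⟩ := exists_walkWeight_eq_wdist w hG u v
    rw [← hp]
    refine (iInf_le _ p).trans ?_
    rw [walkWeight, walkWeight, ← List.sum_map_mul_left]
    exact List.sum_le_sum fun e _ => by exact_mod_cast hle2 e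
  refine ⟨H, hTH, hHG, ?_, fun x hx y => ?_⟩
  · rw [hwT, hwH] at hext
    have hM0 : (M : ℝ≥0∞) ≠ 0 := by exact_mod_cast hMpos.ne'
    rw [mul_comm, ← ENNReal.le_div_iff_mul_le (Or.inl hM0) (Or.inl ENNReal.coe_ne_top)] at hext
    refine hext.trans (le_of_eq ?_)
    rw [ENNReal.ofReal_div_of_pos (by exact_mod_cast hMpos), ENNReal.ofReal_coe_nnreal,
      div_eq_mul_inv, div_eq_mul_inv]
    ring
  · refine (hd1 x y).trans ((hspan x hx y).trans ?_)
    rw [ENNReal.ofReal_mul (p := 746 * 2 ^ A) (by positivity), ENNReal.ofReal_coe_nnreal,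
      mul_assoc]
    exact mul_le_mul_right (hd2 x y) _

end Graph

/-! ### Density nets -/

section Nets

variable {V : Type*} [Fintype V] {G : SimpleGraph V} (w : Sym2 V → ℝ≥0)

/-- The minimum in the definition of `farRadius` is attained. -/
lemma le_ncard_ball_farRadius (v : V) {ε : ℝ} (hε : ε ≤ 1) :
    ε * (Fintype.card V : ℝ) ≤ ({u : V | wdist G w v u ≤ farRadius G w v ε}.ncard : ℝ) := by
  classical
  set S := {r : ℝ≥0∞ | ε * (Fintype.card V : ℝ) ≤ ({u : V | wdist G w v u ≤ r}.ncard : ℝ)} with hS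
  have htop : ∞ ∈ S := by
    have : {u : V | wdist G w v u ≤ ∞} = Set.univ := by ext; simp
    simp only [hS, Set.mem_ofPred_eq, this, Set.ncard_univ, Nat.card_eq_fintype_card]
    exact mul_le_of_le_one_left (Nat.cast_nonneg _) hε
  have hfar : farRadius G w v ε = sInf S := rfl
  -- the ball does not change if the radius is slightly increased
  have hex : ∃ r ∈ S, ∀ u, wdist G w v u ≤ r → wdist G w v u ≤ sInf S := by
    by_cases hne : (Finset.univ.filter fun u => sInf S < wdist G w v u).Nonempty
    · obtain ⟨u₀, hu₀, hmin⟩ := Finset.exists_min_image _ (fun u => wdist G w v u) hne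
      obtain ⟨r, hr, hr'⟩ := sInf_lt_iff.1 (Finset.mem_filter.1 hu₀).2
      refine ⟨r, hr, fun u hu => ?_⟩
      by_contra hlt
      have := hmin u (Finset.mem_filter.2 ⟨Finset.mem_univ _, not_le.1 hlt⟩)
      exact absurd (this.trans hu) (not_le.2 hr')
    · refine ⟨∞, htop, fun u _ => ?_⟩
      by_contra hlt
      exact hne ⟨u, Finset.mem_filter.2 ⟨Finset.mem_univ _, not_le.1 hlt⟩⟩
  obtain ⟨r, hr, hball⟩ := hex
  rw [hfar]
  refine le_trans hr (Nat.cast_le.2 (Set.ncard_le_ncard (fun u hu => hball u hu) (Set.toFinite _)))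

lemma farRadius_mono (v : V) {ε ε' : ℝ} (h : ε ≤ ε') :
    farRadius G w v ε ≤ farRadius G w v ε' :=
  sInf_le_sInf fun _ hr => le_trans (mul_le_mul_of_nonneg_right h (Nat.cast_nonneg _)) hr

/-- A set of at most `1 / ε` vertices such that every vertex `u` is within twice its
`ε`-radius of the set: vertices are considered by increasing `ε`-radius, and the balls of the
selected vertices are disjoint. -/
lemma exists_density_net (hG : G.Connected) {ε : ℝ} (hε : ε ≤ 1) :
    ∃ N : Finset V, N.Nonempty ∧ ε * N.card ≤ 1 ∧
      ∀ u, ∃ z ∈ N, wdist G w u z ≤ 2 * farRadius G w u ε := by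
  classical
  set ball : V → Finset V := fun v =>
    Finset.univ.filter fun u => wdist G w v u ≤ farRadius G w v ε with hball
  have hcard : ∀ v, ε * (Fintype.card V : ℝ) ≤ ((ball v).card : ℝ) := fun v => by
    have h := le_ncard_ball_farRadius (G := G) w v hε
    have : {u : V | wdist G w v u ≤ farRadius G w v ε} = (ball v : Set V) := by
      ext
      simp [hball]
    rwa [this, Set.ncard_coe_finset] at h
  have main : ∀ S : Finset V, ∃ N ⊆ S,
      (∀ z ∈ N, ∀ z' ∈ N, z ≠ z' → Disjoint (ball z) (ball z')) ∧
      ∀ u ∈ S, ∃ z ∈ N, wdist G w u z ≤ 2 * farRadius G w u ε := by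
    intro S
    induction S using Finset.induction_on_max_value (fun v => farRadius G w v ε) with
    | empty => exact ⟨∅, by simp⟩
    | insert a S ha hmax ih =>
      obtain ⟨N, hNS, hdis, hcov⟩ := ih
      by_cases h : ∃ z ∈ N, ¬ Disjoint (ball a) (ball z)
      · obtain ⟨z, hz, hnd⟩ := h
        refine ⟨N, hNS.trans (Finset.subset_insert _ _), hdis, fun u hu => ?_⟩
        rcases Finset.mem_insert.1 hu with rfl | hu
        · obtain ⟨x, hx1, hx2⟩ := Finset.not_disjoint_iff.1 hnd
          have h1 := (Finset.mem_filter.1 hx1).2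
          have h2 := (Finset.mem_filter.1 hx2).2
          refine ⟨z, hz, (wdist_triangle w hG u x z).trans ?_⟩
          rw [wdist_comm w x z, two_mul]
          exact add_le_add h1 (h2.trans (hmax z (hNS hz)))
        · exact hcov u hu
      · push Not at h
        refine ⟨insert a N, Finset.insert_subset_insert _ hNS, ?_, fun u hu => ?_⟩
        · intro z hz z' hz' hne
          rcases Finset.mem_insert.1 hz with h1 | h1 <;> rcases Finset.mem_insert.1 hz' with h2 | h2
          · exact absurd (h1.trans h2.symm) hne
          · exact h1 ▸ h z' h2
          · exact h2 ▸ (h z h1).symm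
          · exact hdis z h1 z' h2 hne
        · rcases Finset.mem_insert.1 hu with rfl | hu
          · exact ⟨u, Finset.mem_insert_self _ _, by simp [wdist_self]⟩
          · obtain ⟨z, hz, hz'⟩ := hcov u hu
            exact ⟨z, Finset.mem_insert_of_mem hz, hz'⟩
  obtain ⟨N, -, hdis, hcov⟩ := main Finset.univ
  have := hG.nonempty
  refine ⟨N, ?_, ?_, fun u => hcov u (Finset.mem_univ u)⟩
  · obtain ⟨v⟩ := hG.nonempty
    obtain ⟨z, hz, -⟩ := hcov v (Finset.mem_univ v)
    exact ⟨z, hz⟩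
  · have hn : (0 : ℝ) < Fintype.card V := by exact_mod_cast Fintype.card_pos
    have h1 : ∑ z ∈ N, (ball z).card ≤ Fintype.card V := by
      rw [← Finset.card_biUnion hdis]
      exact Finset.card_le_univ _
    have h2 : (N.card : ℝ) * (ε * Fintype.card V) ≤ Fintype.card V := by
      have h3 : (N.card : ℝ) * (ε * Fintype.card V) ≤ ∑ z ∈ N, ((ball z).card : ℝ) := by
        rw [← nsmul_eq_mul]
        exact Finset.card_nsmul_le_sum _ _ _ fun z _ => hcard z
      exact h3.trans (by exact_mod_cast h1)
    nlinarith

end Nets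

/-! ### The union of the spanners for all density levels -/

section Union

variable {V : Type*} [Fintype V] {G T : SimpleGraph V} (w : Sym2 V → ℝ≥0)

lemma extraWeight_iSup_le (H : ℕ → SimpleGraph V) :
    extraWeight T (⨆ i, H i) w ≤ ∑' i, extraWeight T (H i) w := by
  classical
  unfold extraWeight
  simp_rw [Finset.sum_filter]
  rw [Summable.tsum_finsetSum fun _ _ => ENNReal.summable]
  refine Finset.sum_le_sum fun e _ => ?_
  by_cases h : e ∈ (⨆ i, H i).edgeSet ∧ e ∉ T.edgeSet
  · rw [if_pos h]
    rw [SimpleGraph.edgeSet_iSup, Set.mem_iUnion] at h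
    obtain ⟨⟨i, hi⟩, heT⟩ := h
    refine le_trans ?_ (ENNReal.le_tsum i)
    simp [hi, heT]
  · rw [if_neg h]
    exact zero_le

/-- The sum of `1 / ((i + 1) (i + 2))` telescopes. -/
lemma tsum_ofReal_div_le {ρ : ℝ} (hρ : 0 ≤ ρ) :
    ∑' i : ℕ, ENNReal.ofReal (ρ / (((i : ℝ) + 1) * (i + 2))) ≤ ENNReal.ofReal ρ := by
  refine ENNReal.tsum_le_of_sum_range_le fun n => ?_
  rw [← ENNReal.ofReal_sum_of_nonneg fun i _ => by positivity]
  refine ENNReal.ofReal_le_ofReal ?_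
  have h : ∀ n : ℕ, ∑ i ∈ Finset.range n, ρ / (((i : ℝ) + 1) * (i + 2)) = ρ - ρ / (n + 1) := by
    intro n
    induction n with
    | zero => simp
    | succ n ih =>
      rw [Finset.sum_range_succ, ih]
      push_cast
      field_simp
      ring
  rw [h]
  have : 0 ≤ ρ / ((n : ℝ) + 1) := by positivity
  linarith

/-- Distortion bound for the pairs that are far at density level `2 ^ (-2 ^ i)`, up to a
constant and the factor `1 / ρ`. -/
noncomputable def levelBound (i : ℕ) : ℝ := 2 ^ i * ((i : ℝ) + 1) ^ 3

/-- A spanner of lightness `1 + ρ` in which, for all density levels at the same time, the pairs that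
are far with respect to this level have small distortion. -/
theorem exists_spanner_levels (hG : G.Connected) {ρ : ℝ} (hρ : 0 < ρ) (hρ1 : ρ < 1) :
    ∃ H ≤ G, lightness G H w ≤ ENNReal.ofReal (1 + ρ) ∧
      ∀ (i : ℕ) (u v : V), farRadius G w u ((1 / 2) ^ 2 ^ i) ≤ wdist G w u v →
        wdist H w u v ≤ ENNReal.ofReal (1283358720 * levelBound i / ρ) * wdist G w u v := by
  classical
  obtain ⟨T, hTmin⟩ : ∃ T : {T : SimpleGraph V // T ≤ G ∧ T.IsTree},
      ∀ T', weight T.1 w ≤ weight (T' : {T : SimpleGraph V // T ≤ G ∧ T.IsTree}).1 w := by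
    obtain ⟨T, hTG, hT⟩ := hG.exists_isTree_le
    have : Nonempty {T : SimpleGraph V // T ≤ G ∧ T.IsTree} := ⟨⟨T, hTG, hT⟩⟩
    exact Finite.exists_min fun T : {T : SimpleGraph V // T ≤ G ∧ T.IsTree} => weight T.1 w
  obtain ⟨T, hTG, hT⟩ := T
  have hmst : mstWeight G w = weight T w :=
    le_antisymm (iInf_le (fun T : {T : SimpleGraph V // T ≤ G ∧ T.IsTree} => weight T.1 w)
      ⟨T, hTG, hT⟩) (le_iInf hTmin)
  have hWT : weight T w ≠ ∞ := by
    rw [weight]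
    exact ENNReal.sum_ne_top.2 fun _ _ => ENNReal.coe_ne_top
  have hnet : ∀ i : ℕ, ∃ N : Finset V, N.Nonempty ∧ ((1 / 2 : ℝ) ^ 2 ^ i) * N.card ≤ 1 ∧
      ∀ u, ∃ z ∈ N, wdist G w u z ≤ 2 * farRadius G w u ((1 / 2) ^ 2 ^ i) := fun i =>
    exists_density_net w hG (pow_le_one₀ (by norm_num) (by norm_num))
  choose N hN hNcard hNcov using hnet
  -- the stretch factors make the additional weight at level `i` equal to `ρ / ((i + 1) (i + 2))`
  -- times the weight of `T`
  set M : ℕ → ℝ≥0 := fun i =>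
    ⟨448 * ((i + 6 : ℕ) : ℝ) * ((i : ℝ) + 1) * (i + 2) / ρ, by positivity⟩ with hM
  have hMcoe : ∀ i, (M i : ℝ) = 448 * ((i + 6 : ℕ) : ℝ) * ((i : ℝ) + 1) * (i + 2) / ρ :=
    fun i => rfl
  -- `2 ^ i ≤ 2 ^ (i + 6) - 2`, so that the net at level `i` is small enough for `A = i + 6`
  have hspan : ∀ i, ∃ H, T ≤ H ∧ H ≤ G ∧
      extraWeight T H w ≤ ENNReal.ofReal (448 * (i + 6 : ℕ) / M i) * weight T w ∧
      ∀ x ∈ N i, ∀ y, wdist H w x y ≤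
        ENNReal.ofReal (746 * 2 ^ (i + 6) * M i) * wdist G w x y := by
    intro i
    refine exists_terminal_spanner_scaled w hG hTG hT.connected (N i) (hN i) (by omega) ?_ ?_
    · have h1 : ((N i).card : ℝ) ≤ 2 ^ 2 ^ i := by
        have h := hNcard i
        rw [one_div, inv_pow, inv_mul_le_iff₀ (by positivity), mul_one] at h
        exact h
      have h2 : (N i).card ≤ 2 ^ 2 ^ i := by exact_mod_cast h1
      refine h2.trans (Nat.pow_le_pow_right (by norm_num) ?_)
      have : 1 ≤ 2 ^ i := Nat.one_le_two_pow
      rw [pow_add]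
      omega
    · rw [← NNReal.coe_le_coe, hMcoe, NNReal.coe_one, le_div_iff₀ hρ]
      push_cast
      have : (0 : ℝ) ≤ i := Nat.cast_nonneg i
      nlinarith [mul_nonneg this this, mul_nonneg (mul_nonneg this this) this]
  choose H hTH hHG hext hdist using hspan
  have hHsup : (⨆ i, H i) ≤ G := iSup_le hHG
  have hTsup : T ≤ ⨆ i, H i := (hTH 0).trans (le_iSup H 0)
  have hHc : (⨆ i, H i).Connected := hT.connected.mono hTsup
  refine ⟨⨆ i, H i, hHsup, ?_, fun i u v hfar => ?_⟩
  · rw [lightness, hmst]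
    refine ENNReal.div_le_of_le_mul ((weight_le_add_extraWeight w T _).trans ?_)
    rw [ENNReal.ofReal_add zero_le_one hρ.le, ENNReal.ofReal_one, add_mul, one_mul]
    refine add_le_add le_rfl ((extraWeight_iSup_le w H).trans ?_)
    calc ∑' i, extraWeight T (H i) w
        ≤ ∑' i : ℕ, ENNReal.ofReal (ρ / (((i : ℝ) + 1) * (i + 2))) * weight T w := by
          refine ENNReal.tsum_le_tsum fun i => (hext i).trans (le_of_eq ?_)
          congr 2
          rw [hMcoe]
          field_simp
      _ = (∑' i : ℕ, ENNReal.ofReal (ρ / (((i : ℝ) + 1) * (i + 2)))) * weight T w :=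
          ENNReal.tsum_mul_right
      _ ≤ ENNReal.ofReal ρ * weight T w := mul_le_mul_left (tsum_ofReal_div_le hρ.le) _
  · obtain ⟨z, hz, hzu⟩ := hNcov i u
    set D := wdist G w u v with hD
    have huz : wdist G w u z ≤ 2 * D := hzu.trans (mul_le_mul_right hfar 2)
    have hzv : wdist G w z v ≤ 3 * D := by
      refine (wdist_triangle w hG z u v).trans ?_
      rw [wdist_comm w z u]
      calc wdist G w u z + D ≤ 2 * D + D := add_le_add huz le_rfl
        _ = 3 * D := by ring
    have hanti : ∀ x y, wdist (⨆ i, H i) w x y ≤ wdist (H i) w x y :=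
      wdist_anti w (le_iSup H i)
    set s := ENNReal.ofReal (746 * 2 ^ (i + 6) * M i) with hs
    have h1 : wdist (⨆ i, H i) w u z ≤ s * (2 * D) := by
      refine (hanti u z).trans ?_
      rw [wdist_comm]
      refine (hdist i z hz u).trans (mul_le_mul_right ?_ s)
      rwa [wdist_comm]
    have h2 : wdist (⨆ i, H i) w z v ≤ s * (3 * D) :=
      (hanti z v).trans ((hdist i z hz v).trans (mul_le_mul_right hzv s))
    calc wdist (⨆ i, H i) w u v ≤ s * (2 * D) + s * (3 * D) :=
          (wdist_triangle w hHc u z v).trans (add_le_add h1 h2)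
      _ = 5 * s * D := by ring
      _ ≤ _ := by
          refine mul_le_mul_left ?_ D
          rw [hs, show (5 : ℝ≥0∞) = ENNReal.ofReal 5 by simp,
            ← ENNReal.ofReal_mul (by norm_num)]
          refine ENNReal.ofReal_le_ofReal ?_
          rw [hMcoe, levelBound, ← mul_div_assoc, ← mul_div_assoc]
          refine div_le_div_of_nonneg_right ?_ hρ.le
          have hi : (0 : ℝ) ≤ i := Nat.cast_nonneg i
          have h3 : ((i : ℝ) + 6) * (i + 2) ≤ (6 * (i + 1)) * (2 * (i + 1)) := by
            gcongr <;> linarith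
          have h4 : (0 : ℝ) ≤ 2 ^ i * (i + 1) := by positivity
          have h5 := mul_le_mul_of_nonneg_left h3 h4
          rw [pow_add]
          push_cast
          nlinarith

end Union

/-! ### Coarse scaling distortion -/

/-- A density level `i` with `2 ^ (-2 ^ i) ≤ ε / 2`, where `2 ^ i` is of the order of
`log (1 / ε)`. -/
lemma exists_level {ε : ℝ} (hε0 : 0 < ε) (hε1 : ε < 1) :
    ∃ i : ℕ, (1 / 2 : ℝ) ^ 2 ^ i ≤ ε / 2 ∧
      levelBound i ≤ 256 * (1 + Real.log (1 / ε)) * (1 + Real.log (1 + Real.log (1 / ε))) ^ 3 := by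
  have hlog2 := Real.log_two_gt_d9
  have hlog2' := Real.log_two_lt_d9
  set x := Real.log (1 / ε) with hx
  have hx0 : 0 < x := Real.log_pos (by rw [lt_div_iff₀ hε0]; linarith)
  set y := Real.log (1 + x) with hy
  have hy0 : 0 < y := Real.log_pos (by linarith)
  have hex : ∃ i : ℕ, x + Real.log 2 ≤ 2 ^ i * Real.log 2 := by
    obtain ⟨i, hi⟩ := pow_unbounded_of_one_lt ((x + Real.log 2) / Real.log 2) one_lt_two
    exact ⟨i, by rw [← div_le_iff₀ (by linarith)]; exact hi.le⟩
  set i := Nat.find hex with hi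
  have hi1 : x + Real.log 2 ≤ 2 ^ i * Real.log 2 := Nat.find_spec hex
  have hi2 : (2 : ℝ) ^ i ≤ 4 * (1 + x) := by
    rcases Nat.eq_zero_or_pos i with h0 | h0
    · rw [h0, pow_zero]
      linarith
    · have h := Nat.find_min hex (m := i - 1) (by omega)
      rw [not_le] at h
      have h2 : (2 : ℝ) ^ i = 2 * 2 ^ (i - 1) := by
        rw [← pow_succ']
        congr 1
        omega
      nlinarith
  have hi3 : (i : ℝ) + 1 ≤ 4 * (1 + y) := by
    have h := Real.log_le_log (by positivity) hi2
    rw [Real.log_pow, Real.log_mul (by norm_num) (by linarith), ← hy,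
      show (4 : ℝ) = 2 ^ 2 by norm_num, Real.log_pow] at h
    push_cast at h
    nlinarith
  refine ⟨i, ?_, ?_⟩
  · rw [← Real.log_le_log_iff (by positivity) (by positivity), Real.log_pow, one_div, Real.log_inv,
      Real.log_div hε0.ne' (by norm_num)]
    rw [hx, one_div, Real.log_inv] at hi1
    push_cast
    linarith
  · have h1 : ((i : ℝ) + 1) ^ 3 ≤ (4 * (1 + y)) ^ 3 := by gcongr
    calc levelBound i ≤ (4 * (1 + x)) * (4 * (1 + y)) ^ 3 := by
          unfold levelBound
          gcongr
      _ = _ := by ring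

/-! ### Average distortion -/

/-- The estimate that makes the `q`-th moments of `levelBound` summable. -/
lemma levelBound_le_exp (i : ℕ) {q : ℝ} (hq : 1 ≤ q) :
    levelBound i ≤ 7000 * (q * (1 + Real.log q) ^ 3) * Real.exp (2 ^ i * Real.log 2 / (2 * q)) := by
  have hlog2 := Real.log_two_gt_d9
  have hlog2' := Real.log_two_lt_d9
  have hlq : 0 ≤ Real.log q := Real.log_nonneg hq
  have hq0 : 0 < q := by linarith
  set x : ℝ := 2 ^ i with hx
  have hx0 : 0 < x := by positivity
  have hlogx : Real.log x = i * Real.log 2 := by rw [hx, Real.log_pow]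
  have hi : (0 : ℝ) ≤ i := Nat.cast_nonneg i
  unfold levelBound
  rw [← hx]
  have hQ : 0 ≤ q * (1 + Real.log q) ^ 3 := by positivity
  rcases le_total x q with h | h
  · have h1 : Real.log x ≤ Real.log q := Real.log_le_log hx0 h
    have h2 : (i : ℝ) + 1 ≤ 2 * (1 + Real.log q) := by nlinarith
    have h3 : 1 ≤ Real.exp (x * Real.log 2 / (2 * q)) := Real.one_le_exp (by positivity)
    calc x * ((i : ℝ) + 1) ^ 3 ≤ q * (2 * (1 + Real.log q)) ^ 3 := by gcongr
      _ = 8 * (q * (1 + Real.log q) ^ 3) * 1 := by ring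
      _ ≤ 7000 * (q * (1 + Real.log q) ^ 3) * Real.exp (x * Real.log 2 / (2 * q)) := by
          gcongr
          norm_num
  · set y := x / q with hy
    have hy1 : 1 ≤ y := by rw [hy, le_div_iff₀ hq0]; linarith
    have hxy : x = q * y := by rw [hy]; field_simp
    have h1 : Real.log x = Real.log q + Real.log y := by
      rw [hxy, Real.log_mul hq0.ne' (by linarith)]
    have h2 : Real.log y ≤ y - 1 := Real.log_le_sub_one_of_pos (by linarith)
    have h3 : (i : ℝ) + 1 ≤ 3 / 2 * ((1 + Real.log q) * y) := by
      have h4 : i * Real.log 2 ≤ Real.log q + (y - 1) := by linarith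
      have h5 : (i : ℝ) ≤ 3 / 2 * (Real.log q + (y - 1)) := by nlinarith
      nlinarith
    set z := x * Real.log 2 / (2 * q) with hz
    have hzy : 34 / 100 * y ≤ z := by
      have : z = y * (Real.log 2 / 2) := by rw [hz, hy]; field_simp
      rw [this]
      nlinarith
    have h6 : z ^ 4 / 24 ≤ Real.exp z := by
      have := Real.pow_div_factorial_le_exp z (by linarith) 4
      simpa [Nat.factorial] using this
    have h7 : (34 / 100 * y) ^ 4 ≤ z ^ 4 := by gcongr
    have h8 : y ^ 4 ≤ 1800 * Real.exp z := by
      have : (34 / 100 * y) ^ 4 = (34 / 100) ^ 4 * y ^ 4 := by ring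
      rw [this] at h7
      have : (0 : ℝ) ≤ y ^ 4 := by positivity
      norm_num at h7
      linarith
    calc x * ((i : ℝ) + 1) ^ 3 ≤ (q * y) * (3 / 2 * ((1 + Real.log q) * y)) ^ 3 := by
          rw [hxy]
          gcongr
      _ = 27 / 8 * (q * (1 + Real.log q) ^ 3) * y ^ 4 := by ring
      _ ≤ 27 / 8 * (q * (1 + Real.log q) ^ 3) * (1800 * Real.exp z) := by gcongr
      _ ≤ 7000 * (q * (1 + Real.log q) ^ 3) * Real.exp z := by
          have := mul_nonneg hQ (Real.exp_pos z).le
          linarith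

lemma levelBound_pos (i : ℕ) : 0 < levelBound i := by
  unfold levelBound
  positivity

lemma levelBound_succ_le (i : ℕ) : levelBound (i + 1) ≤ 16 * levelBound i := by
  unfold levelBound
  have h : ((i + 1 : ℕ) : ℝ) + 1 ≤ 2 * (i + 1) := by
    push_cast
    have : (0 : ℝ) ≤ i := Nat.cast_nonneg i
    linarith
  calc (2 : ℝ) ^ (i + 1) * (((i + 1 : ℕ) : ℝ) + 1) ^ 3
      ≤ 2 ^ (i + 1) * (2 * ((i : ℝ) + 1)) ^ 3 := by gcongr
    _ = _ := by ring

lemma mul_levelBound_rpow_le (i : ℕ) {q : ℝ} (hq : 1 ≤ q) :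
    (1 / 2 : ℝ) ^ 2 ^ i * levelBound i ^ q ≤
      (1 / 2) ^ i * (7000 * (q * (1 + Real.log q) ^ 3)) ^ q := by
  have hq0 : 0 < q := by linarith
  have hlq : 0 ≤ Real.log q := Real.log_nonneg hq
  set Q := 7000 * (q * (1 + Real.log q) ^ 3) with hQ
  have hQ0 : 0 ≤ Q := by positivity
  have h1 : levelBound i ^ q ≤ Q ^ q * Real.exp (2 ^ i * Real.log 2 / 2) := by
    refine (Real.rpow_le_rpow (levelBound_pos i).le (levelBound_le_exp i hq) hq0.le).trans
      (le_of_eq ?_)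
    rw [Real.mul_rpow hQ0 (Real.exp_pos _).le, ← Real.exp_mul]
    congr 2
    field_simp
  have h2 : (1 / 2 : ℝ) ^ 2 ^ i = Real.exp (-(2 ^ i * Real.log 2)) := by
    rw [← Real.exp_log (by positivity : (0 : ℝ) < (1 / 2) ^ 2 ^ i), Real.log_pow, one_div,
      Real.log_inv]
    push_cast
    ring_nf
  have h3 : (1 / 2 : ℝ) ^ i = Real.exp (-(i * Real.log 2)) := by
    rw [← Real.exp_log (by positivity : (0 : ℝ) < (1 / 2) ^ i), Real.log_pow, one_div,
      Real.log_inv]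
    ring_nf
  have h4 : 2 * (i : ℝ) ≤ 2 ^ i := by
    have : ∀ i : ℕ, 2 * i ≤ 2 ^ i := by
      intro i
      induction i with
      | zero => simp
      | succ i ih =>
        have : 1 ≤ 2 ^ i := Nat.one_le_two_pow
        rcases i with _ | i
        · simp
        · rw [pow_succ]
          omega
    exact_mod_cast this i
  calc (1 / 2 : ℝ) ^ 2 ^ i * levelBound i ^ q
      ≤ Real.exp (-(2 ^ i * Real.log 2)) * (Q ^ q * Real.exp (2 ^ i * Real.log 2 / 2)) := by
        rw [h2]
        gcongr
    _ = Real.exp (-(2 ^ i * Real.log 2 / 2)) * Q ^ q := by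
        rw [mul_left_comm, ← Real.exp_add, mul_comm]
        congr 2
        ring
    _ ≤ _ := by
        rw [h3]
        gcongr
        have := Real.log_two_gt_d9
        nlinarith

section Average

variable {V : Type*} [Fintype V] {G H : SimpleGraph V} (w : Sym2 V → ℝ≥0)

/-- Only few vertices are within the `ε`-radius of a vertex `u`. -/
lemma card_near_le [DecidableEq V] (u : V) {ε : ℝ} (hε0 : 0 ≤ ε) (hε : ε ≤ 1) :
    ((Finset.univ.filter fun v => v ≠ u ∧ wdist G w u v < farRadius G w u ε).card : ℝ) ≤
      ε * ((Fintype.card V : ℝ) - 1) := by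
  classical
  have hn : (1 : ℝ) ≤ Fintype.card V := by
    exact_mod_cast Fintype.card_pos_iff.2 ⟨u⟩
  set B := Finset.univ.filter fun v => wdist G w u v < farRadius G w u ε with hB
  have herase : (Finset.univ.filter fun v => v ≠ u ∧ wdist G w u v < farRadius G w u ε) =
      B.erase u := by
    ext v
    simp [hB]
  rw [herase]
  rcases B.eq_empty_or_nonempty with h | hne
  · rw [h]
    simp only [Finset.erase_empty, Finset.card_empty, Nat.cast_zero]
    exact mul_nonneg hε0 (by linarith)
  · obtain ⟨v₀, hv₀, hmax⟩ := Finset.exists_max_image B (fun v => wdist G w u v) hne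
    have hlt := (Finset.mem_filter.1 hv₀).2
    have huB : u ∈ B := by
      refine Finset.mem_filter.2 ⟨Finset.mem_univ _, ?_⟩
      rw [wdist_self]
      exact lt_of_le_of_lt zero_le hlt
    have hball : ¬ ε * (Fintype.card V : ℝ) ≤
        ({v : V | wdist G w u v ≤ wdist G w u v₀}.ncard : ℝ) := by
      intro h
      have hle : farRadius G w u ε ≤ wdist G w u v₀ := sInf_le h
      exact absurd hle (not_le.2 hlt)
    have hsub : B.card ≤ {v : V | wdist G w u v ≤ wdist G w u v₀}.ncard := by
      rw [← Set.ncard_coe_finset]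
      exact Set.ncard_le_ncard (fun v hv => hmax v hv) (Set.toFinite _)
    have hcard := Finset.card_erase_add_one huB
    have h1 : ((B.erase u).card : ℝ) + 1 = B.card := by exact_mod_cast hcard
    have h2 : (B.card : ℝ) ≤ ({v : V | wdist G w u v ≤ wdist G w u v₀}.ncard : ℝ) := by
      exact_mod_cast hsub
    rw [not_le] at hball
    linarith

/-- The fraction of the ordered pairs that are not far at density `ε` is at most `ε`. -/
lemma card_near_pairs_le [DecidableEq V] {ε : ℝ} (hε0 : 0 ≤ ε) (hε : ε ≤ 1) :
    (((Finset.univ : Finset V).offDiag.filter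
      fun p => wdist G w p.1 p.2 < farRadius G w p.1 ε).card : ℝ) ≤
      ε * ((Finset.univ : Finset V).offDiag.card : ℝ) := by
  classical
  set S := (Finset.univ : Finset V).offDiag.filter
      fun p => wdist G w p.1 p.2 < farRadius G w p.1 ε with hS
  have hfib : S.card = ∑ u : V, (S.filter fun p => p.1 = u).card :=
    Finset.card_eq_sum_card_fiberwise fun p _ => Finset.mem_univ _
  have hle : ∀ u : V, ((S.filter fun p => p.1 = u).card : ℝ) ≤
      ε * ((Fintype.card V : ℝ) - 1) := by
    intro u
    refine le_trans (Nat.cast_le.2 ?_) (card_near_le (G := G) w u hε0 hε)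
    refine Finset.card_le_card_of_injOn Prod.snd ?_ ?_
    · intro p hp
      simp only [hS, Finset.coe_filter, Finset.mem_filter, Finset.mem_offDiag, Finset.mem_univ,
        true_and, Set.mem_ofPred_eq] at hp ⊢
      obtain ⟨⟨h1, h2⟩, rfl⟩ := hp
      exact ⟨fun h => h1 h.symm, h2⟩
    · intro p hp p' hp' h
      have h1 := (Finset.mem_filter.1 hp).2
      have h2 := (Finset.mem_filter.1 hp').2
      exact Prod.ext (h1.trans h2.symm) h
  have hoff : ((Finset.univ : Finset V).offDiag.card : ℝ) =
      Fintype.card V * ((Fintype.card V : ℝ) - 1) := by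
    rw [Finset.offDiag_card, Finset.card_univ, Nat.cast_sub (Nat.le_mul_self _)]
    push_cast
    ring
  rw [hfib, hoff]
  push_cast
  calc ∑ u : V, ((S.filter fun p => p.1 = u).card : ℝ)
      ≤ ∑ _u : V, ε * ((Fintype.card V : ℝ) - 1) := Finset.sum_le_sum fun u _ => hle u
    _ = _ := by
        rw [Finset.sum_const, Finset.card_univ, nsmul_eq_mul]
        ring

/-- A pair that is far at level `i` has distortion at most `a i`; if `i` is the first such level, it
is not far at level `i - 1`, which happens for few pairs only. Hence the average
of the `q`-th power of the distortion is bounded by a series. -/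
lemma average_distortion_le {a : ℕ → ℝ} (ha : ∀ i, 0 ≤ a i)
    (hH : ∀ (i : ℕ) (u v : V), farRadius G w u ((1 / 2) ^ 2 ^ i) ≤ wdist G w u v →
        wdist H w u v ≤ ENNReal.ofReal (a i) * wdist G w u v) {q : ℝ} (hq : 0 ≤ q) :
    lqDistortion G H w q ≤ (ENNReal.ofReal (a 0 ^ q) +
      ∑' i : ℕ, ENNReal.ofReal ((1 / 2) ^ 2 ^ i * a (i + 1) ^ q)) ^ (1 / q) := by
  classical
  unfold lqDistortion
  refine ENNReal.rpow_le_rpow ?_ (by positivity)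
  refine ENNReal.div_le_of_le_mul ?_
  set O := (Finset.univ : Finset V).offDiag with hO
  have hpow : ∀ i, 0 ≤ a i ^ q := fun i => Real.rpow_nonneg (ha i) q
  have hpt : ∀ p : V × V, (wdist H w p.1 p.2 / wdist G w p.1 p.2) ^ q ≤
      ENNReal.ofReal (a 0 ^ q) + ∑' i : ℕ,
        if wdist G w p.1 p.2 < farRadius G w p.1 ((1 / 2) ^ 2 ^ i) then
          ENNReal.ofReal (a (i + 1) ^ q) else 0 := by
    intro p
    have hratio : ∀ i, farRadius G w p.1 ((1 / 2) ^ 2 ^ i) ≤ wdist G w p.1 p.2 →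
        (wdist H w p.1 p.2 / wdist G w p.1 p.2) ^ q ≤ ENNReal.ofReal (a i ^ q) := by
      intro i hi
      rw [← ENNReal.ofReal_rpow_of_nonneg (ha i) hq]
      exact ENNReal.rpow_le_rpow (ENNReal.div_le_of_le_mul (hH i _ _ hi)) hq
    -- at a fine enough level, the radius is zero
    have hex : ∃ i : ℕ, farRadius G w p.1 ((1 / 2) ^ 2 ^ i) ≤ wdist G w p.1 p.2 := by
      refine ⟨Fintype.card V, (sInf_le ?_).trans zero_le⟩
      have h1 : ({u : V | wdist G w p.1 u ≤ 0}.ncard : ℝ) ≥ 1 := by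
        have : 0 < {u : V | wdist G w p.1 u ≤ 0}.ncard :=
          (Set.ncard_pos (Set.toFinite _)).2 ⟨p.1, (wdist_self w p.1).le⟩
        exact_mod_cast this
      refine le_trans ?_ h1
      have h2 : (Fintype.card V : ℝ) ≤ 2 ^ 2 ^ Fintype.card V := by
        have := (Nat.lt_two_pow_self (n := Fintype.card V)).le.trans
          (Nat.lt_two_pow_self (n := 2 ^ Fintype.card V)).le
        exact_mod_cast this
      rw [one_div, inv_pow, inv_mul_le_iff₀ (by positivity), mul_one]
      exact h2
    rcases Nat.eq_zero_or_pos (Nat.find hex) with h0 | h0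
    · have hs := Nat.find_spec hex
      rw [h0] at hs
      exact (hratio 0 hs).trans le_self_add
    · have hlt := Nat.find_min hex (m := Nat.find hex - 1) (by omega)
      refine le_trans ?_ (le_add_left (ENNReal.le_tsum (Nat.find hex - 1)))
      rw [if_pos (not_le.1 hlt), Nat.sub_add_cancel h0]
      exact hratio _ (Nat.find_spec hex)
  calc ∑ p ∈ O, (wdist H w p.1 p.2 / wdist G w p.1 p.2) ^ q
      ≤ ∑ p ∈ O, (ENNReal.ofReal (a 0 ^ q) + ∑' i : ℕ,
        if wdist G w p.1 p.2 < farRadius G w p.1 ((1 / 2) ^ 2 ^ i) then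
          ENNReal.ofReal (a (i + 1) ^ q) else 0) := Finset.sum_le_sum fun p _ => hpt p
    _ = O.card * ENNReal.ofReal (a 0 ^ q) + ∑' i : ℕ, ∑ p ∈ O,
        if wdist G w p.1 p.2 < farRadius G w p.1 ((1 / 2) ^ 2 ^ i) then
          ENNReal.ofReal (a (i + 1) ^ q) else 0 := by
        rw [Finset.sum_add_distrib, Summable.tsum_finsetSum fun _ _ => ENNReal.summable,
          Finset.sum_const, nsmul_eq_mul]
    _ ≤ O.card * ENNReal.ofReal (a 0 ^ q) + ∑' i : ℕ,
        ENNReal.ofReal ((1 / 2) ^ 2 ^ i * a (i + 1) ^ q) * O.card := by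
        refine add_le_add le_rfl (ENNReal.tsum_le_tsum fun i => ?_)
        rw [← Finset.sum_filter, Finset.sum_const, nsmul_eq_mul,
          ← ENNReal.ofReal_natCast, ← ENNReal.ofReal_natCast,
          ← ENNReal.ofReal_mul (Nat.cast_nonneg _),
          ← ENNReal.ofReal_mul (mul_nonneg (by positivity) (hpow _))]
        refine ENNReal.ofReal_le_ofReal ?_
        have := card_near_pairs_le (G := G) w (ε := (1 / 2) ^ 2 ^ i) (by positivity)
          (pow_le_one₀ (by norm_num) (by norm_num))
        calc _ ≤ ((1 / 2 : ℝ) ^ 2 ^ i * O.card) * a (i + 1) ^ q :=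
              mul_le_mul_of_nonneg_right this (hpow _)
          _ = _ := by ring
    _ = _ := by
        rw [ENNReal.tsum_mul_right]
        ring

/-- If the distortion at density level `i` is at most `c` times `levelBound i`, then the
`ℓ_q`-distortion is of the order of `c q (1 + log q) ^ 3`. -/
lemma lqDistortion_le {c : ℝ} (hc : 0 ≤ c)
    (hH : ∀ (i : ℕ) (u v : V), farRadius G w u ((1 / 2) ^ 2 ^ i) ≤ wdist G w u v →
        wdist H w u v ≤ ENNReal.ofReal (c * levelBound i) * wdist G w u v) {q : ℝ} (hq : 1 ≤ q) :
    lqDistortion G H w q ≤ ENNReal.ofReal (336000 * c * (q * (1 + Real.log q) ^ 3)) := by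
  have hq0 : 0 < q := by linarith
  have hlq : 0 ≤ Real.log q := Real.log_nonneg hq
  set Q := q * (1 + Real.log q) ^ 3 with hQ
  have hQ1 : 1 ≤ Q := one_le_mul_of_one_le_of_one_le hq (one_le_pow₀ (by linarith))
  set B := 16 * c * (7000 * Q) with hB
  have hB0 : 0 ≤ B := by positivity
  refine (average_distortion_le w (fun i => mul_nonneg hc (levelBound_pos i).le) hH hq0.le).trans ?_
  have h0 : (c * levelBound 0) ^ q ≤ B ^ q := by
    refine Real.rpow_le_rpow (mul_nonneg hc (levelBound_pos 0).le) ?_ hq0.le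
    have : levelBound 0 = 1 := by simp [levelBound]
    rw [this, hB]
    nlinarith
  have hi : ∀ i : ℕ, (1 / 2 : ℝ) ^ 2 ^ i * (c * levelBound (i + 1)) ^ q ≤ (1 / 2) ^ i * B ^ q := by
    intro i
    have h1 : (c * levelBound (i + 1)) ^ q ≤ (16 * c) ^ q * levelBound i ^ q := by
      rw [← Real.mul_rpow (by positivity) (levelBound_pos i).le]
      refine Real.rpow_le_rpow (mul_nonneg hc (levelBound_pos _).le) ?_ hq0.le
      calc c * levelBound (i + 1) ≤ c * (16 * levelBound i) :=
            mul_le_mul_of_nonneg_left (levelBound_succ_le i) hc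
        _ = 16 * c * levelBound i := by ring
    calc (1 / 2 : ℝ) ^ 2 ^ i * (c * levelBound (i + 1)) ^ q
        ≤ (1 / 2 : ℝ) ^ 2 ^ i * ((16 * c) ^ q * levelBound i ^ q) := by gcongr
      _ = (16 * c) ^ q * ((1 / 2 : ℝ) ^ 2 ^ i * levelBound i ^ q) := by ring
      _ ≤ (16 * c) ^ q * ((1 / 2) ^ i * (7000 * Q) ^ q) :=
          mul_le_mul_of_nonneg_left (mul_levelBound_rpow_le i hq)
            (Real.rpow_nonneg (by positivity) _)
      _ = (1 / 2) ^ i * B ^ q := by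
          rw [hB, Real.mul_rpow (x := 16 * c) (y := 7000 * Q) (by positivity) (by positivity)]
          exact mul_left_comm _ _ _
  have hBq : 0 ≤ B ^ q := Real.rpow_nonneg hB0 q
  have hsum : ∑' i : ℕ, ENNReal.ofReal ((1 / 2) ^ i * B ^ q) = ENNReal.ofReal (2 * B ^ q) := by
    have hg := hasSum_geometric_two.mul_right (B ^ q)
    rw [← hg.tsum_eq, ENNReal.ofReal_tsum_of_nonneg (fun i => by positivity) hg.summable]
  have hfin : ENNReal.ofReal ((c * levelBound 0) ^ q) +
      ∑' i : ℕ, ENNReal.ofReal ((1 / 2) ^ 2 ^ i * (c * levelBound (i + 1)) ^ q) ≤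
      ENNReal.ofReal ((3 * B) ^ q) := by
    calc _ ≤ ENNReal.ofReal (B ^ q) + ENNReal.ofReal (2 * B ^ q) := by
          rw [← hsum]
          exact add_le_add (ENNReal.ofReal_le_ofReal h0)
            (ENNReal.tsum_le_tsum fun i => ENNReal.ofReal_le_ofReal (hi i))
      _ = ENNReal.ofReal (3 * B ^ q) := by
          rw [← ENNReal.ofReal_add hBq (by positivity)]
          congr 1
          ring
      _ ≤ _ := by
          refine ENNReal.ofReal_le_ofReal ?_
          rw [Real.mul_rpow (by norm_num) hB0]
          refine mul_le_mul_of_nonneg_right ?_ hBq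
          exact Real.self_le_rpow_of_one_le (by norm_num) hq
  refine (ENNReal.rpow_le_rpow hfin (by positivity)).trans (le_of_eq ?_)
  rw [← ENNReal.ofReal_rpow_of_nonneg (by positivity) hq0.le, ← ENNReal.rpow_mul,
    mul_one_div_cancel hq0.ne', ENNReal.rpow_one, hB]
  congr 1
  ring

end Average

end LightSpanner

theorem mainTheorem4 :
    ∃ (C : ℝ) (k : ℕ), 0 < C ∧
      ∀ (ρ : ℝ), 0 < ρ → ρ < 1 →
      ∀ (V : Type*) [Fintype V] (G : SimpleGraph V) (w : Sym2 V → ℝ≥0), G.Connected →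
        ∃ H : SimpleGraph V, H ≤ G ∧
          LightSpanner.lightness G H w ≤ ENNReal.ofReal (1 + ρ) ∧
          LightSpanner.HasCoarseScalingDistortion G H w
            (fun ε => C * (1 + Real.log (1 / ε)) *
              (1 + Real.log (1 + Real.log (1 / ε))) ^ k / ρ) ∧
          ∀ q : ℝ, 1 ≤ q →
            LightSpanner.lqDistortion G H w q ≤
              ENNReal.ofReal (C * q * (1 + Real.log q) ^ k / ρ) := by
  -- the first factor comes from the passage to `q`-th moments, the second one is the constant in the
  -- distortion at each density level
  refine ⟨336000 * 1283358720, 3, by norm_num, fun ρ hρ hρ1 V _ G w hG => ?_⟩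
  obtain ⟨H, hHG, hlight, hdist⟩ := LightSpanner.exists_spanner_levels w hG hρ hρ1
  refine ⟨H, hHG, hlight, fun ε hε0 hε1 u v _ hfar => ?_, fun q hq => ?_⟩
  · obtain ⟨i, hi, hbound⟩ := LightSpanner.exists_level hε0 hε1
    have hfar' : LightSpanner.farRadius G w u ((1 / 2) ^ 2 ^ i) ≤ LightSpanner.wdist G w u v := by
      rw [LightSpanner.wdist_comm]
      exact (LightSpanner.farRadius_mono w u hi).trans hfar
    refine (hdist i u v hfar').trans (mul_le_mul_left (ENNReal.ofReal_le_ofReal ?_) _)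
    refine div_le_div_of_nonneg_right ?_ hρ.le
    have := (LightSpanner.levelBound_pos i).trans_le hbound
    nlinarith
  · refine (LightSpanner.lqDistortion_le w (c := 1283358720 / ρ) (by positivity)
      (fun i u v h => ?_) hq).trans (le_of_eq ?_)
    · rw [div_mul_eq_mul_div]
      exact hdist i u v h
    · congr 1
      ring
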